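/- Consider undirected graphs $G=(V,E)$ on $n$ vertices with maximum degree at most $\Delta$, where $\Delta\ge 2$ is an integer and every edge has a cost in $\{0,1\}$. Let $\delta(u,v)$ be the cost of a cheapest path from $u$ to $v$ ($\infty$ if there is none) and $\ell(u,v)$ the least number of edges on such a cheapest path. For an integer $r\ge 1$ let $B_u(r)$ be the set of vertices reachable from $u$ by at most $r$ edges, and for $0\le k<r$ let $L_u^r(k)=\{v:\ \ell(u,v)<\infty,\ \ell(u,v)\equiv k \pmod r\}$. A hub family of radius $r$ consists of the sets $S(u)=B_u(r)\cup L^r_u(\mathrm{offset}(u))$, $u\in V$, where $0\le \mathrm{offset}(u)<r$ and $|L^r_u(\mathrm{offset}(u))|\le n/r$, such that any $u,v$ in the same connected component have a common hub $w\in S(u)\cap S(v)$ with $\delta(u,w)+\delta(w,v)=\delta(u,v)$. Theorem. Let $\Delta\le T\le n$ with $T$ real, and put $R=\log_\Delta T\ge 1$. Then every such graph has a hub family of radius $\lfloor R\rfloor$, and it has an exact distance labeling with labels of $O\!\left(\frac nR\log(1+R)\right)$ bits and decoding time $O(T)$. That is, there are absolute constants and one fixed program for a word RAM with word size $\Theta(\log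 n)$ bits (unit cost for arithmetic, bitwise operations, memory access, jumps, and for reading up to one word of consecutive bits of an input string) such that, for all such $n,\Delta,T,G$, bit strings of the stated length can be assigned to the vertices so that the program, given only the strings of $u$ and $v$, outputs $\delta(u,v)$ within $O(T)$ steps. Moreover, there are an integer $r$ depending only on $n,\Delta,T$, with $\frac14R\le r\le R$, $r\ge1$, and $r=\lfloor R\rfloor$ whenever $T\log_2^2 n\le n$, and a hub family of radius $r$ such that, for a suitable numbering of the vertices, the label of each $u$ stores its hub set together with distances: the set $\{(\mathrm{number}(w),\delta(u,w)):w\in S(u)\}$ can be read off from the label of $u$ by one fixed function that does not depend on the graph. -/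

import Mathlib

/-! ### Distances, balls, layers and hub sets in graphs with edge costs -/

namespace DistLabel

variable {V : Type*}

/-- The cost of a walk: the sum of the costs of its edges. -/
def walkCost {G : SimpleGraph V} (c : Sym2 V → ℕ) {u v : V} (p : G.Walk u v) : ℕ :=
  (p.edges.map c).sum

/-- `δ(u,v)`: the cost of a cheapest path from `u` to `v`; it is `∞` when there is no path. -/
noncomputable def dist (G : SimpleGraph V) (c : Sym2 V → ℕ) (u v : V) : ℕ∞ :=
  ⨅ p : G.Walk u v, (walkCost c p : ℕ∞)

/-- `ℓ(u,v)`: the smallest number of edges on a cheapest path from `u` to `v`;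
it is `∞` when there is no path. -/
noncomputable def hops (G : SimpleGraph V) (c : Sym2 V → ℕ) (u v : V) : ℕ∞ :=
  ⨅ p : {p : G.Walk u v // (walkCost c p : ℕ∞) = dist G c u v}, (p.1.length : ℕ∞)

/-- `B_u(r)`: the vertices that can be reached from `u` by following at most `r` edges. -/
def ball (G : SimpleGraph V) (r : ℕ) (u : V) : Set V :=
  {v | ∃ p : G.Walk u v, p.length ≤ r}

/-- `L_u(k)`, with respect to the modulus `r`: the vertices `v` (reachable from `u`) with
`ℓ(u,v) ≡ k (mod r)`. -/
def layer (G : SimpleGraph V) (c : Sym2 V → ℕ) (r : ℕ) (u : V) (k : ℕ) : Set V :=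
  {v | ∃ m : ℕ, hops G c u v = (m : ℕ∞) ∧ m ≡ k [MOD r]}

/-- The hub set `S(u) = B_u(r) ∪ L_u(offset(u))`. -/
def hubSet (G : SimpleGraph V) (c : Sym2 V → ℕ) (r : ℕ) (offset : V → ℕ) (u : V) : Set V :=
  ball G r u ∪ layer G c r u (offset u)

/-- Each chosen layer class is one of the `r` classes modulo `r`, and contains at most `|V| / r`
vertices. -/
def SparseOffset (G : SimpleGraph V) (c : Sym2 V → ℕ) (r : ℕ) (offset : V → ℕ) : Prop :=
  ∀ u, offset u < r ∧ r * (layer G c r u (offset u)).ncard ≤ Nat.card V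

/-- The family `S` is a shortest path cover: any two vertices joined by a path have a common hub
on a cheapest path between them. -/
def ShortestPathCover (G : SimpleGraph V) (c : Sym2 V → ℕ) (S : V → Set V) : Prop :=
  ∀ u v, G.Reachable u v →
    ∃ x ∈ S u ∩ S v, dist G c u x + dist G c x v = dist G c u v

end DistLabel

/-! ### A word RAM with read-only access to two bit strings -/

namespace WordRAM

/-- Binary operations on words. -/
inductive Op
  | add | sub | mul | div | mod | and | or | xor | shl | shr

/-- The result of an operation on `w`-bit words, as a `w`-bit word. Addition, subtraction and
multiplication are modulo `2 ^ w`. -/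
def Op.eval (w : ℕ) : Op → ℕ → ℕ → ℕ
  | .add, a, b => (a + b) % 2 ^ w
  | .sub, a, b => (a + (2 ^ w - b)) % 2 ^ w
  | .mul, a, b => (a * b) % 2 ^ w
  | .div, a, b => (a / b) % 2 ^ w
  | .mod, a, b => (a % b) % 2 ^ w
  | .and, a, b => (a &&& b) % 2 ^ w
  | .or, a, b => (a ||| b) % 2 ^ w
  | .xor, a, b => (a ^^^ b) % 2 ^ w
  | .shl, a, b => (a * 2 ^ b) % 2 ^ w
  | .shr, a, b => (a / 2 ^ b) % 2 ^ w

/-- Instructions. Registers are numbered by natural numbers; a program, being finite, uses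
finitely many of them. -/
inductive Instr
  /-- `const i a`: put the constant `a` into register `i`. -/
  | const (i a : ℕ)
  /-- `op o i j k`: put the result of `o` on registers `j` and `k` into register `i`. -/
  | op (o : Op) (i j k : ℕ)
  /-- `load i j`: put the memory cell whose address is in register `j` into register `i`. -/
  | load (i j : ℕ)
  /-- `store i j`: put register `j` into the memory cell whose address is in register `i`. -/
  | store (i j : ℕ)
  /-- `read s i j k`: put into register `i` the consecutive bits of the first (`s = false`) or the
  second (`s = true`) input string that start at the position in register `j`; their number is in
  register `k`, and at most one word is read. -/
  | read (s : Bool) (i j k : ℕ)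
  /-- `jumpLt i j l`: continue with instruction `l` if register `i` is less than register `j`. -/
  | jumpLt (i j l : ℕ)
  /-- `halt i`: stop; the output is the content of register `i`. -/
  | halt (i : ℕ)

/-- A configuration: program counter, registers, memory. -/
structure State where
  pc : ℕ
  reg : ℕ → ℕ
  mem : ℕ → ℕ

/-- The initial configuration. -/
def State.init : State := ⟨0, fun _ => 0, fun _ => 0⟩

/-- Put `a` into register `i` and go to the next instruction. -/
def State.set (s : State) (i a : ℕ) : State :=
  ⟨s.pc + 1, Function.update s.reg i a, s.mem⟩

/-- The `m` bits of `x` from position `p` on, as a number (the first bit is the least significant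
one); positions after the end of `x` read as zero. -/
def readBits (x : List Bool) (p m : ℕ) : ℕ :=
  ∑ t ∈ Finset.range m, (x.getD (p + t) false).toNat * 2 ^ t

/-- Execution of one instruction other than `halt`, with word size `w` and inputs `x`, `y`. -/
def exec (w : ℕ) (x y : List Bool) (s : State) : Instr → State
  | .const i a => s.set i (a % 2 ^ w)
  | .op o i j k => s.set i (o.eval w (s.reg j) (s.reg k))
  | .load i j => s.set i (s.mem (s.reg j))
  | .store i j => ⟨s.pc + 1, s.reg, Function.update s.mem (s.reg i) (s.reg j)⟩
  | .read b i j k => s.set i (readBits (cond b y x) (s.reg j) (min (s.reg k) w))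
  | .jumpLt i j l => if s.reg i < s.reg j then ⟨l, s.reg, s.mem⟩ else ⟨s.pc + 1, s.reg, s.mem⟩
  | .halt _ => s

/-- Run the program `P` for at most the given number of steps; the result is the output if the
program has halted by then, and `none` otherwise. Every instruction takes one step. -/
def run (w : ℕ) (P : List Instr) (x y : List Bool) : ℕ → State → Option ℕ
  | 0, _ => none
  | t + 1, s =>
    match P[s.pc]? with
    | none => none
    | some (.halt i) => some (s.reg i)
    | some ins => run w P x y t (exec w x y s ins)

/-- With word size `w`, the program `P` outputs `out` on the inputs `x`, `y` after at most `t`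
steps. -/
def OutputsWithin (w : ℕ) (P : List Instr) (x y : List Bool) (t out : ℕ) : Prop :=
  run w P x y t State.init = some out

end WordRAM

namespace DistLabel

/-- How a program outputs a distance: `0` stands for `∞`, and `d + 1` for the finite value `d`. -/
def distCode : ℕ∞ → ℕ
  | none => 0
  | some d => d + 1

end DistLabel

/-! Consider a cheapest walk from `u` to `v` with the fewest edges. Its prefixes are of the same
kind, so its `i`-th vertex `x` has `ℓ(u,x) = i`, and if the walk has at least `r` edges, one of its
last `r` vertices lies in the layer class chosen for `u`; if it is shorter, `u` itself is near `v`.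
So some hub of `u` on a cheapest walk lies within `r - 1` edges of `v` (`exists_hub_mem_ball`). A
sparse class exists by pigeonhole (`exists_sparseOffset`).

Hence `δ(u,v)` is the minimum of `δ(u,x) + δ(x,v)` over those `x` in the ball of radius `r - 1`
about `v` that are hubs of `u`. The label of `v` lists this ball, fewer than `2 * Δ ^ (r - 1)`
candidates. The label of `u` must tell in constant time whether `x` is a hub and at which distance.

To store the hubs compactly, the vertices are numbered so that mutually reachable vertices with
numbers `i` and `j` are at most `3 * |i - j|` edges apart (`exists_numbering`). The distance from
`u` is then a 3-Lipschitz function of the number, and a hub at gap `g` from the previous one costs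
only `O(1 + log g)` bits, distance included. With `O(n / r)` hubs this adds up to `O(n log (1 + r) /
r)` bits (`mul_pointer_le`).

For random access the numbers are cut into blocks of about `log n / 64` positions. A block code has
at most about `log n / 4` bits, so a table that decodes all codes has about `n ^ (1/4)` rows and
fits into the label. Absolute positions and distances are kept per superblock and relative ones per
block, which costs `O(n log log n / log n)` bits. Since `log (1 + x) / x` is almost decreasing and
`R = O(log n)`, both costs are `O(n log (1 + R) / R)` (`size_div_le`). If balls of radius `⌊R⌋`
might be too large for this space bound, a radius of about `R / 2`, but at least 1, is taken
(`exists_radius`). -/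

namespace DistLabel

/-! ### Cheapest walks, the hub property, and the sizes of layers and balls. -/

section Metric

variable {V : Type*} {G : SimpleGraph V} {c : Sym2 V → ℕ} {u v x : V}

theorem walkCost_append (p : G.Walk u v) (q : G.Walk v x) :
    walkCost c (p.append q) = walkCost c p + walkCost c q := by
  simp [walkCost, SimpleGraph.Walk.edges_append]

theorem walkCost_reverse (p : G.Walk u v) : walkCost c p.reverse = walkCost c p := by
  simp [walkCost, SimpleGraph.Walk.edges_reverse, List.sum_reverse]

/-- All that is ever used about the costs: an edge costs at most 1, so a walk with few edges bounds
the distance. -/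
theorem walkCost_le_length (hc : ∀ e ∈ G.edgeSet, c e = 0 ∨ c e = 1) (p : G.Walk u v) :
    walkCost c p ≤ p.length := by
  have h := List.sum_le_card_nsmul (p.edges.map c) 1 (by
    intro a ha
    obtain ⟨e, he, rfl⟩ := List.mem_map.1 ha
    rcases hc e (p.edges_subset_edgeSet he) with h | h <;> omega)
  simpa [walkCost] using h

theorem dist_le_walkCost (p : G.Walk u v) : dist G c u v ≤ walkCost c p := iInf_le _ p

theorem exists_walkCost_eq_dist (h : G.Reachable u v) :
    ∃ p : G.Walk u v, (walkCost c p : ℕ∞) = dist G c u v := by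
  have : Nonempty (G.Walk u v) := h
  exact ciInf_mem fun p : G.Walk u v => (walkCost c p : ℕ∞)

theorem dist_ne_top_iff : dist G c u v ≠ ⊤ ↔ G.Reachable u v := by
  constructor
  · intro h
    by_contra hn
    have : IsEmpty (G.Walk u v) := not_nonempty_iff.1 hn
    exact h (by simp [dist])
  · intro h
    obtain ⟨p, hp⟩ := exists_walkCost_eq_dist (c := c) h
    rw [← hp]
    exact ENat.natCast_ne_top _

theorem dist_comm : dist G c u v = dist G c v u := by
  apply le_antisymm
  · exact le_iInf fun p => (dist_le_walkCost p.reverse).trans_eq (by rw [walkCost_reverse])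
  · exact le_iInf fun p => (dist_le_walkCost p.reverse).trans_eq (by rw [walkCost_reverse])

theorem dist_self : dist G c u u = 0 :=
  nonpos_iff_eq_zero.1 ((dist_le_walkCost (SimpleGraph.Walk.nil : G.Walk u u)).trans_eq
    (by simp [walkCost]))

theorem dist_triangle (u v x : V) : dist G c u x ≤ dist G c u v + dist G c v x := by
  by_cases h1 : G.Reachable u v
  · by_cases h2 : G.Reachable v x
    · obtain ⟨p, hp⟩ := exists_walkCost_eq_dist (c := c) h1
      obtain ⟨q, hq⟩ := exists_walkCost_eq_dist (c := c) h2
      rw [← hp, ← hq, ← Nat.cast_add, ← walkCost_append]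
      exact dist_le_walkCost _
    · rw [← dist_ne_top_iff (c := c), not_not] at h2
      simp [h2]
  · rw [← dist_ne_top_iff (c := c), not_not] at h1
    simp [h1]

theorem exists_walk_hops (h : G.Reachable u v) :
    ∃ p : G.Walk u v, (walkCost c p : ℕ∞) = dist G c u v ∧ hops G c u v = p.length := by
  obtain ⟨q, hq⟩ := exists_walkCost_eq_dist (c := c) h
  have : Nonempty {p : G.Walk u v // (walkCost c p : ℕ∞) = dist G c u v} := ⟨⟨q, hq⟩⟩
  obtain ⟨p, hp⟩ := ciInf_mem fun p : {p : G.Walk u v // (walkCost c p : ℕ∞) = dist G c u v} =>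
    (p.1.length : ℕ∞)
  exact ⟨p.1, p.2, hp.symm⟩

theorem hops_le_length (p : G.Walk u v) (hp : (walkCost c p : ℕ∞) = dist G c u v) :
    hops G c u v ≤ p.length :=
  iInf_le (fun p : {p : G.Walk u v // (walkCost c p : ℕ∞) = dist G c u v} => (p.1.length : ℕ∞))
    ⟨p, hp⟩

theorem reachable_of_hops_eq {m : ℕ} (h : hops G c u v = m) : G.Reachable u v := by
  by_contra hn
  have : IsEmpty {p : G.Walk u v // (walkCost c p : ℕ∞) = dist G c u v} :=
    ⟨fun p => hn ⟨p.1⟩⟩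
  simp [hops] at h

/-- A prefix of a cheapest walk with the fewest edges is again such a walk. -/
theorem prefix_of_cheapest (p : G.Walk u x) (q : G.Walk x v)
    (hd : (walkCost c (p.append q) : ℕ∞) = dist G c u v)
    (hh : hops G c u v = (p.append q).length) :
    hops G c u x = p.length ∧ dist G c u x + dist G c x v = dist G c u v := by
  -- `p` and `q` together are cheapest among all walks through `x`; changing one half at a time
  -- shows that each half is cheapest.
  have hmin : ∀ (p' : G.Walk u x) (q' : G.Walk x v),
      walkCost c p + walkCost c q ≤ walkCost c p' + walkCost c q' := by
    intro p' q'
    have := dist_le_walkCost (c := c) (p'.append q')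
    rw [← hd, Nat.cast_le] at this
    simpa [walkCost_append] using this
  have hp : dist G c u x = walkCost c p := by
    apply le_antisymm (dist_le_walkCost p)
    refine le_iInf fun p' => ?_
    have := hmin p' q
    exact_mod_cast (by omega : walkCost c p ≤ walkCost c p')
  have hq : dist G c x v = walkCost c q := by
    apply le_antisymm (dist_le_walkCost q)
    refine le_iInf fun q' => ?_
    have := hmin p q'
    exact_mod_cast (by omega : walkCost c q ≤ walkCost c q')
  refine ⟨le_antisymm (hops_le_length p hp.symm) (le_iInf fun p' => ?_), ?_⟩
  -- A cheapest walk to `x` with fewer edges than `p`, continued by `q`, would contradict `hh`.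
  · have h1 : walkCost c p'.1 = walkCost c p := by exact_mod_cast p'.2.trans hp
    have h2 := hops_le_length (p'.1.append q) (by
      rw [walkCost_append, h1, ← walkCost_append, hd])
    rw [hh, Nat.cast_le, SimpleGraph.Walk.length_append, SimpleGraph.Walk.length_append] at h2
    exact_mod_cast (by omega : p.length ≤ p'.1.length)
  · rw [hp, hq, ← hd, walkCost_append, Nat.cast_add]

theorem reachable_of_mem_ball {r : ℕ} (h : v ∈ ball G r u) : G.Reachable u v :=
  let ⟨p, _⟩ := h
  ⟨p⟩

theorem reachable_of_mem_hubSet {r : ℕ} {offset : V → ℕ} (h : v ∈ hubSet G c r offset u) :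
    G.Reachable u v := by
  rcases h with h | ⟨m, h, _⟩
  · exact reachable_of_mem_ball h
  · exact reachable_of_hops_eq h

theorem self_mem_ball (r : ℕ) : u ∈ ball G r u := ⟨.nil, by simp⟩

theorem ball_mono {r s : ℕ} (h : r ≤ s) : ball G r u ⊆ ball G s u :=
  fun _ ⟨p, hp⟩ => ⟨p, hp.trans h⟩

/-- Among the last `r` vertices of a cheapest walk from `u` to `v` there is a hub of `u`. -/
theorem exists_hub_mem_ball {r : ℕ} (hr : 1 ≤ r) {offset : V → ℕ} (ho : offset u < r)
    (h : G.Reachable u v) :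
    ∃ x ∈ ball G (r - 1) v, x ∈ hubSet G c r offset u ∧
      dist G c u x + dist G c x v = dist G c u v := by
  obtain ⟨p, hd, hh⟩ := exists_walk_hops (c := c) h
  by_cases hlen : p.length ≤ r - 1
  · exact ⟨u, ⟨p.reverse, by simpa using hlen⟩, Or.inl (self_mem_ball r), by simp [dist_self]⟩
  -- `i` is the largest index up to `p.length` in the class of `offset u`. Adding `r` before
  -- subtracting the offset makes the quotient `q + 1` and keeps the subtraction from truncating.
  · obtain ⟨i, hi1, hi2, hi3⟩ : ∃ i, i ≤ p.length ∧ p.length - i ≤ r - 1 ∧ i ≡ offset u [MOD r] := by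
      have hm := Nat.div_add_mod (p.length + r - offset u) r
      have hm' := Nat.mod_lt (p.length + r - offset u) hr
      have hq : 1 ≤ (p.length + r - offset u) / r := by
        rw [Nat.one_le_div_iff hr]
        omega
      obtain ⟨q, hq'⟩ : ∃ q, (p.length + r - offset u) / r = q + 1 := ⟨_, (Nat.sub_add_cancel hq).symm⟩
      rw [hq'] at hm
      have : r * (q + 1) = r * q + r := by ring
      refine ⟨r * q + offset u, by omega, by omega, ?_⟩
      simp [Nat.ModEq]
    have happ := p.append_take_drop_eq i
    have h2 := prefix_of_cheapest (c := c) (p.take i) (p.drop i) (by rw [happ, hd])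
      (by rw [happ, hh])
    refine ⟨p.getVert i, ⟨(p.drop i).reverse, ?_⟩, Or.inr ⟨i, ?_, hi3⟩, h2.2⟩
    · simpa [SimpleGraph.Walk.drop_length] using hi2
    · rw [h2.1, SimpleGraph.Walk.take_length, min_eq_left hi1]

theorem shortestPathCover_hubSet {r : ℕ} (hr : 1 ≤ r) {offset : V → ℕ} (ho : ∀ u, offset u < r) :
    ShortestPathCover G c (hubSet G c r offset) := by
  intro u v h
  obtain ⟨x, hx, hx', hd⟩ := exists_hub_mem_ball (c := c) hr (ho u) h
  exact ⟨x, ⟨hx', Or.inl (ball_mono (Nat.sub_le r 1) hx)⟩, hd⟩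

theorem layer_disjoint {r k l : ℕ} (hk : k < r) (hl : l < r) (h : k ≠ l) :
    Disjoint (layer G c r u k) (layer G c r u l) := by
  rw [Set.disjoint_left]
  rintro x ⟨m, hm, hmk⟩ ⟨m', hm', hml⟩
  have : m = m' := by exact_mod_cast hm.symm.trans hm'
  subst this
  exact h (Nat.ModEq.eq_of_lt_of_lt (hmk.symm.trans hml) hk hl)

/-- Pigeonhole: if each of the `r` disjoint classes had more than `n / r` vertices, there would be
more than `n` in all. -/
theorem exists_sparseOffset [Finite V] (G : SimpleGraph V) (c : Sym2 V → ℕ) {r : ℕ} (hr : 1 ≤ r) :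
    ∃ offset : V → ℕ, SparseOffset G c r offset := by
  classical
  have := Fintype.ofFinite V
  have key : ∀ u, ∃ k, k < r ∧ r * (layer G c r u k).ncard ≤ Nat.card V := by
    intro u
    by_contra! hcon
    have h1 : ∑ k ∈ Finset.range r, (layer G c r u k).toFinset.card ≤ Nat.card V := by
      rw [← Finset.card_biUnion, Nat.card_eq_fintype_card]
      · exact Finset.card_le_univ _
      · intro k hk l hl hkl
        rw [Function.onFun, Set.disjoint_toFinset]
        exact layer_disjoint (Finset.mem_range.1 hk) (Finset.mem_range.1 hl) hkl
    have h2 : ∑ k ∈ Finset.range r, Nat.card V <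
        ∑ k ∈ Finset.range r, r * (layer G c r u k).toFinset.card := by
      apply Finset.sum_lt_sum_of_nonempty (by simpa using (by omega : r ≠ 0))
      intro k hk
      rw [← Set.ncard_eq_toFinset_card']
      exact hcon k (Finset.mem_range.1 hk)
    rw [← Finset.mul_sum, Finset.sum_const, Finset.card_range, smul_eq_mul] at h2
    exact absurd (Nat.lt_of_mul_lt_mul_left h2) (not_lt.2 h1)
  choose offset h1 using key
  exact ⟨offset, h1⟩

/-- The form `2 * Δ ^ r - 1` is preserved by the recursion `b ↦ 1 + Δ * b` exactly because `Δ ≥ 2`.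
-/
theorem ncard_ball_le [Fintype V] [DecidableRel G.Adj] {Δ : ℕ} (hΔ : 2 ≤ Δ)
    (hdeg : ∀ v, G.degree v ≤ Δ) (r : ℕ) (u : V) : (ball G r u).ncard + 1 ≤ 2 * Δ ^ r := by
  classical
  induction r generalizing u with
  | zero =>
    have : ball G 0 u ⊆ {u} := by
      rintro v ⟨p, hp⟩
      exact (SimpleGraph.Walk.eq_of_length_eq_zero (Nat.le_zero.1 hp)).symm
    have := Set.ncard_le_ncard this
    simp at this ⊢
    omega
  | succ r ih =>
    have hsub : ball G (r + 1) u ⊆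
        insert u (((G.neighborFinset u).biUnion fun v => (ball G r v).toFinset : Finset V) : Set V) := by
      rintro v ⟨p, hp⟩
      cases p with
      | nil => simp
      | cons hadj q =>
        right
        simp only [Finset.coe_biUnion, Set.mem_iUnion, Set.coe_toFinset]
        exact ⟨_, by simpa using hadj, q, by simpa using hp⟩
    have h1 := Set.ncard_le_ncard hsub
    have h2 := Set.ncard_insert_le u
      (((G.neighborFinset u).biUnion fun v => (ball G r v).toFinset : Finset V) : Set V)
    rw [Set.ncard_coe_finset] at h2
    have h3 : ((G.neighborFinset u).biUnion fun v => (ball G r v).toFinset).card ≤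
        (G.neighborFinset u).card * (2 * Δ ^ r - 1) := by
      apply Finset.card_biUnion_le_card_mul
      intro v _
      rw [← Set.ncard_eq_toFinset_card']
      have := ih v
      omega
    rw [SimpleGraph.card_neighborFinset_eq_degree] at h3
    have h4 := Nat.mul_le_mul_right (2 * Δ ^ r - 1) (hdeg u)
    have h5 : Δ * (2 * Δ ^ r - 1) + Δ = 2 * Δ ^ (r + 1) := by
      have : 1 ≤ Δ ^ r := Nat.one_le_pow _ _ (by omega)
      obtain ⟨k, hk⟩ : ∃ k, 2 * Δ ^ r = k + 1 := ⟨2 * Δ ^ r - 1, by omega⟩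
      rw [pow_succ, ← mul_assoc, hk]
      simp only [Nat.add_sub_cancel]
      ring
    omega

end Metric

/-! ### A numbering in which the distance from any vertex varies slowly. -/

section Numbering

variable {V : Type*} {G : SimpleGraph V}

/-- Consecutive entries of the list are joined by walks with at most three edges. -/
def ShortSteps (G : SimpleGraph V) (l : List V) : Prop :=
  l.IsChain fun x y => ∃ p : G.Walk x y, p.length ≤ 3

theorem ShortSteps.reverse {l : List V} (h : ShortSteps G l) : ShortSteps G l.reverse := by
  rw [ShortSteps, List.isChain_reverse]
  refine List.IsChain.imp ?_ h
  rintro x y ⟨p, hp⟩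
  exact ⟨p.reverse, by simpa using hp⟩

theorem ShortSteps.exists_walk {l : List V} (h : ShortSteps G l) {i k : ℕ} {x y : V}
    (hx : l[i]? = some x) (hy : l[i + k]? = some y) : ∃ p : G.Walk x y, p.length ≤ 3 * k := by
  induction k generalizing y with
  | zero =>
    obtain rfl : x = y := Option.some_injective _ (hx.symm.trans hy)
    exact ⟨.nil, by simp⟩
  | succ k ih =>
    obtain ⟨hlt, rfl⟩ := List.getElem?_eq_some_iff.1 hy
    obtain ⟨p, hp⟩ := ih (List.getElem?_eq_getElem (show i + k < l.length by omega))
    obtain ⟨q, hq⟩ := List.isChain_iff_getElem.1 h (i + k) hlt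
    exact ⟨p.append q, by rw [SimpleGraph.Walk.length_append]; omega⟩

/-- Every vertex `a` of a finite set `W` lies in a subset of `W`, closed under adjacency in `W`,
that can be listed in short steps from `a` to `a` or a neighbour of `a`. This is the induction
behind Sekanina's theorem that the cube of a connected graph is Hamiltonian. -/
theorem exists_shortSteps_list [DecidableEq V] (W : Finset V) (a : V) (ha : a ∈ W) :
    ∃ (l : List V) (z : V), l.Nodup ∧ l.head? = some a ∧ l.getLast? = some z ∧ (z = a ∨ G.Adj a z) ∧
      ShortSteps G l ∧ (∀ x ∈ l, x ∈ W) ∧ ∀ x ∈ l, ∀ y ∈ W, G.Adj x y → y ∈ l := by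
  induction hn : W.card using Nat.strong_induction_on generalizing W a with
  | _ n ih =>
  subst hn
  by_cases hb : ∃ b ∈ W, G.Adj a b
  · obtain ⟨b, hbW, hab⟩ := hb
    -- Remove `a` and list the part `l₂` around `b`; then list from `a` what remains of `W`.
    -- Traversing `l₂` backwards makes the whole list end in `b`, a neighbour of `a`.
    obtain ⟨l₂, z₂, hnd₂, hh₂, hl₂, hz₂, hs₂, hW₂, hc₂⟩ := ih (W.erase a).card
      (Finset.card_erase_lt_of_mem ha) (W.erase a) b (Finset.mem_erase.2 ⟨hab.ne', hbW⟩) rfl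
    have hb₂ : b ∈ l₂ := List.mem_of_head? hh₂
    have ha₂ : a ∉ l₂ := fun h => by simpa using hW₂ a h
    obtain ⟨l₁, z₁, hnd₁, hh₁, hl₁, hz₁, hs₁, hW₁, hc₁⟩ := ih (W \ l₂.toFinset).card
      (Finset.card_lt_card (Finset.ssubset_iff_subset_ne.2 ⟨Finset.sdiff_subset, fun h => by
        have : b ∈ W \ l₂.toFinset := by rw [h]; exact hbW
        simp [hb₂] at this⟩)) (W \ l₂.toFinset) a (by simp [ha, ha₂]) rfl
    refine ⟨l₁ ++ l₂.reverse, b, ?_, ?_, ?_, Or.inr hab, ?_, ?_, ?_⟩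
    · refine List.Nodup.append hnd₁ (List.nodup_reverse.2 hnd₂) fun x hx hx' => ?_
      have := hW₁ x hx
      simp at this hx'
      exact this.2 hx'
    · simp [List.head?_append, hh₁]
    · simp [List.getLast?_append, hh₂]
    · refine List.isChain_append.2 ⟨hs₁, hs₂.reverse, ?_⟩
      intro x hx y hy
      rw [hl₁, Option.mem_some_iff] at hx
      rw [List.head?_reverse, hl₂, Option.mem_some_iff] at hy
      subst hx hy
      -- The junction runs from `z₁` over `a` and `b` to `z₂`, with at most one edge for each of the
      -- three parts.
      have w₁ : ∃ p : G.Walk z₁ a, p.length ≤ 1 := by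
        rcases hz₁ with rfl | h
        · exact ⟨.nil, by simp⟩
        · exact ⟨h.symm.toWalk, by simp⟩
      have w₂ : ∃ p : G.Walk b z₂, p.length ≤ 1 := by
        rcases hz₂ with rfl | h
        · exact ⟨.nil, by simp⟩
        · exact ⟨h.toWalk, by simp⟩
      obtain ⟨p, hp⟩ := w₁
      obtain ⟨q, hq⟩ := w₂
      exact ⟨p.append (hab.toWalk.append q), by
        simp only [SimpleGraph.Walk.length_append, SimpleGraph.Adj.length_toWalk]; omega⟩
    · intro x hx
      rcases List.mem_append.1 hx with h | h
      · exact (Finset.mem_sdiff.1 (hW₁ x h)).1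
      · exact Finset.mem_of_mem_erase (hW₂ x (List.mem_reverse.1 h))
    · intro x hx y hy hxy
      rw [List.mem_append, List.mem_reverse] at hx ⊢
      by_cases hy₂ : y ∈ l₂
      · exact Or.inr hy₂
      rcases hx with hx | hx
      · exact Or.inl (hc₁ x hx y (by simp [hy, hy₂]) hxy)
      · by_cases hya : y = a
        · exact Or.inl (hya ▸ List.mem_of_head? hh₁)
        · exact Or.inr (hc₂ x hx y (Finset.mem_erase.2 ⟨hya, hy⟩) hxy)
  · refine ⟨[a], a, by simp, rfl, rfl, Or.inl rfl, List.isChain_singleton _, by simpa using ha, ?_⟩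
    intro x hx y hy hxy
    rw [List.mem_singleton] at hx
    subst hx
    exact absurd ⟨y, hy, hxy⟩ hb

/-- A set of vertices that is closed under adjacency can be listed so that vertices which are
close in the list and connected are close in the graph. -/
theorem exists_list_walk_le [DecidableEq V] (W : Finset V)
    (hW : ∀ x ∈ W, ∀ y, G.Adj x y → y ∈ W) :
    ∃ l : List V, l.Nodup ∧ (∀ x, x ∈ l ↔ x ∈ W) ∧
      ∀ (i k : ℕ) (x y : V), l[i]? = some x → l[i + k]? = some y → G.Reachable x y →
        ∃ p : G.Walk x y, p.length ≤ 3 * k := by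
  induction hn : W.card using Nat.strong_induction_on generalizing W with
  | _ n ih =>
  subst hn
  rcases W.eq_empty_or_nonempty with rfl | ⟨a, ha⟩
  · exact ⟨[], by simp⟩
  obtain ⟨l₁, z, hnd₁, hh₁, -, -, hs₁, hW₁, hc₁⟩ := exists_shortSteps_list (G := G) W a ha
  -- Because `W` is closed under adjacency, `l₁` contains whole components. So no entry of `l₁` is
  -- connected to an entry of the second list, and nothing is required across the boundary.
  have hclosed : ∀ x ∈ l₁, ∀ y, G.Reachable x y → y ∈ l₁ := by
    rintro x hx y ⟨p⟩
    induction p with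
    | nil => exact hx
    | cons hadj q ih' => exact ih' (hc₁ _ hx _ (hW _ (hW₁ _ hx) _ hadj) hadj)
  obtain ⟨l₂, hnd₂, hm₂, hp₂⟩ := ih (W \ l₁.toFinset).card
    (Finset.card_lt_card (Finset.ssubset_iff_subset_ne.2 ⟨Finset.sdiff_subset, fun h => by
      have : a ∈ W \ l₁.toFinset := by rw [h]; exact ha
      simp [List.mem_of_head? hh₁] at this⟩)) (W \ l₁.toFinset) (by
        intro x hx y hxy
        simp only [Finset.mem_sdiff, List.mem_toFinset] at hx ⊢
        exact ⟨hW x hx.1 y hxy, fun hy => hx.2 (hclosed y hy x hxy.symm.reachable)⟩) rfl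
  refine ⟨l₁ ++ l₂, ?_, ?_, ?_⟩
  · refine List.Nodup.append hnd₁ hnd₂ fun x hx hx' => ?_
    have := (hm₂ x).1 hx'
    simp [hx] at this
  · intro x
    rw [List.mem_append, hm₂]
    simp only [Finset.mem_sdiff, List.mem_toFinset]
    have := hW₁ x
    tauto
  · intro i k x y hx hy hreach
    by_cases h2 : i < l₁.length
    · rw [List.getElem?_append_left h2] at hx
      have hy₁ : y ∈ l₁ := hclosed x (List.mem_of_getElem? hx) y hreach
      by_cases h1 : i + k < l₁.length
      · rw [List.getElem?_append_left h1] at hy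
        exact hs₁.exists_walk hx hy
      · rw [List.getElem?_append_right (not_lt.1 h1)] at hy
        have h4 := (hm₂ _).1 (List.mem_of_getElem? hy)
        simp [hy₁] at h4
    · rw [List.getElem?_append_right (not_lt.1 h2)] at hx
      rw [List.getElem?_append_right (by omega), Nat.sub_add_comm (not_lt.1 h2)] at hy
      exact hp₂ _ _ x y hx hy hreach

/-- The sum of the two truncated differences is the absolute difference of the numbers. -/
theorem exists_numbering {n : ℕ} (G : SimpleGraph (Fin n)) :
    ∃ name : Equiv.Perm (Fin n), ∀ x y, G.Reachable x y →
      ∃ p : G.Walk x y, p.length ≤ 3 * (((name x : ℕ) - name y) + ((name y : ℕ) - name x)) := by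
  obtain ⟨l, hnd, hm, hp⟩ := exists_list_walk_le (G := G) Finset.univ (by simp)
  have hlen : l.length = n := by
    have h1 : l.toFinset = Finset.univ := by ext x; simp [hm]
    rw [← List.toFinset_card_of_nodup hnd, h1, Finset.card_univ, Fintype.card_fin]
  let e : Fin n ≃ Fin n := (finCongr hlen.symm).trans (hnd.getEquivOfForallMemList l (by simp [hm]))
  have he : ∀ i : Fin n, e i = l[(i : ℕ)]'(by omega) := fun i => rfl
  refine ⟨e.symm, ?_⟩
  have key : ∀ i j : Fin n, i ≤ j → G.Reachable (e i) (e j) →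
      ∃ p : G.Walk (e i) (e j), p.length ≤ 3 * ((j : ℕ) - i) := by
    intro i j hij h
    obtain ⟨k, hk⟩ := Nat.exists_eq_add_of_le (show (i : ℕ) ≤ j from hij)
    obtain ⟨p, hp⟩ := hp i k (e i) (e j) (by rw [he, List.getElem?_eq_getElem])
      (by rw [he, ← hk, List.getElem?_eq_getElem]) h
    exact ⟨p, by omega⟩
  intro x y h
  obtain ⟨i, rfl⟩ := e.surjective x
  obtain ⟨j, rfl⟩ := e.surjective y
  simp only [Equiv.symm_apply_apply]
  rcases le_total i j with hij | hij
  · obtain ⟨p, hp⟩ := key i j hij h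
    exact ⟨p, by omega⟩
  · obtain ⟨p, hp⟩ := key j i hij h.symm
    exact ⟨p.reverse, by rw [SimpleGraph.Walk.length_reverse]; omega⟩

/-- McShane's extension, for functions with values in `ℕ`. -/
theorem exists_lipschitz_extension {ι : Type*} [Nonempty ι] (p d : ι → ℕ)
    (h : ∀ x y, d x ≤ d y + 3 * ((p x - p y) + (p y - p x))) :
    ∃ e : ℕ → ℕ, (∀ i, e (i + 1) ≤ e i + 3 ∧ e i ≤ e (i + 1) + 3) ∧ (∀ x, e (p x) = d x) ∧
      ∀ x i, e i ≤ d x + 3 * ((i - p x) + (p x - i)) := by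
  let e : ℕ → ℕ := fun i => ⨅ x, (d x + 3 * ((i - p x) + (p x - i)))
  have hmem : ∀ i, ∃ x, d x + 3 * ((i - p x) + (p x - i)) = e i := fun i =>
    ciInf_mem fun x => d x + 3 * ((i - p x) + (p x - i))
  have hle : ∀ x i, e i ≤ d x + 3 * ((i - p x) + (p x - i)) := fun x i =>
    ciInf_le (OrderBot.bddBelow _) x
  refine ⟨e, fun i => ⟨?_, ?_⟩, fun x => ?_, hle⟩
  · obtain ⟨x, hx⟩ := hmem i
    have := hle x (i + 1)
    omega
  · obtain ⟨x, hx⟩ := hmem (i + 1)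
    have := hle x i
    omega
  · obtain ⟨y, hy⟩ := hmem (p x)
    have h1 := hle x (p x)
    have h2 := h x y
    omega

end Numbering

end DistLabel

/-! ### Reading fields of fixed width from a bit string. -/

namespace WordRAM

theorem readBits_succ (x : List Bool) (p m : ℕ) :
    readBits x p (m + 1) = 2 ^ m * (x.getD (p + m) false).toNat + readBits x p m := by
  rw [readBits, Finset.sum_range_succ, ← readBits]
  ring

theorem readBits_lt (x : List Bool) (p m : ℕ) : readBits x p m < 2 ^ m := by
  induction m with
  | zero => simp [readBits]
  | succ m ih =>
    rw [readBits_succ, pow_succ]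
    have := Bool.toNat_le (x.getD (p + m) false)
    nlinarith

theorem testBit_readBits (x : List Bool) (p : ℕ) {m t : ℕ} (ht : t < m) :
    (readBits x p m).testBit t = x.getD (p + t) false := by
  induction m with
  | zero => omega
  | succ m ih =>
    rw [readBits_succ, Nat.testBit_two_pow_mul_add _ (readBits_lt x p m)]
    split_ifs with h
    · exact ih h
    · obtain rfl : t = m := by omega
      cases x.getD (p + t) false <;> simp

theorem readBits_eq_mod {x : List Bool} {p m v : ℕ}
    (h : ∀ t < m, x.getD (p + t) false = v.testBit t) : readBits x p m = v % 2 ^ m := by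
  apply Nat.eq_of_testBit_eq
  intro t
  rw [Nat.testBit_mod_two_pow]
  by_cases ht : t < m
  · simp only [testBit_readBits x p ht, h t ht, ht, decide_true, Bool.true_and]
  · simp only [ht, decide_false, Bool.false_and]
    exact Nat.testBit_lt_two_pow ((readBits_lt x p m).trans_le
      (Nat.pow_le_pow_right two_pos (not_lt.1 ht)))

/-- The `f` lowest bits of `v`. -/
def bitsOf (f v : ℕ) : List Bool := (List.range f).map v.testBit

@[simp] theorem length_bitsOf (f v : ℕ) : (bitsOf f v).length = f := by simp [bitsOf]

theorem getD_bitsOf {f v t : ℕ} (h : t < f) : (bitsOf f v).getD t false = v.testBit t := by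
  simp [bitsOf, List.getD_eq_getElem?_getD, List.getElem?_range h]

theorem bitsOf_readBits (x : List Bool) (p m : ℕ) :
    bitsOf m (readBits x p m) = (List.range m).map fun t => x.getD (p + t) false := by
  refine List.map_congr_left fun t ht => ?_
  exact testBit_readBits x p (List.mem_range.1 ht)

theorem length_flatMap_range (g : ℕ → List Bool) (m : ℕ) :
    ((List.range m).flatMap g).length = ∑ j ∈ Finset.range m, (g j).length := by
  induction m with
  | zero => simp
  | succ m ih => simp [List.range_succ, List.flatMap_append, Finset.sum_range_succ, ih]

theorem getD_flatMap_range (g : ℕ → List Bool) {m i t : ℕ} (hi : i < m) (ht : t < (g i).length) :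
    ((List.range m).flatMap g).getD ((∑ j ∈ Finset.range i, (g j).length) + t) false =
      (g i).getD t false := by
  induction m with
  | zero => omega
  | succ m ih =>
    rw [List.range_succ, List.flatMap_append, List.flatMap_singleton]
    rcases Nat.lt_succ_iff_lt_or_eq.1 hi with h | rfl
    · rw [List.getD_append, ih h]
      rw [length_flatMap_range]
      calc _ < ∑ j ∈ Finset.range (i + 1), (g j).length := by
            rw [Finset.sum_range_succ]; omega
        _ ≤ _ := Finset.sum_le_sum_of_subset (Finset.range_subset_range.2 h)
    · rw [List.getD_append_right _ _ _ _ (by rw [length_flatMap_range]; omega),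
        length_flatMap_range, Nat.add_sub_cancel_left]

/-- The numbers `v 0, …, v (m - 1)`, written with `f` bits each. -/
def array (f m : ℕ) (v : ℕ → ℕ) : List Bool := (List.range m).flatMap fun i => bitsOf f (v i)

@[simp] theorem length_array (f m : ℕ) (v : ℕ → ℕ) : (array f m v).length = m * f := by
  simp [array]

theorem getD_array {f m : ℕ} (v : ℕ → ℕ) {i t : ℕ} (hi : i < m) (ht : t < f) :
    (array f m v).getD (i * f + t) false = (v i).testBit t := by
  rw [array]
  have := getD_flatMap_range (fun i => bitsOf f (v i)) (t := t) hi (by simpa using ht)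
  simpa only [length_bitsOf, Finset.sum_const, Finset.card_range, smul_eq_mul, getD_bitsOf ht]
    using this

theorem readBits_of_array {x : List Bool} {p f m : ℕ} {v : ℕ → ℕ}
    (h : ∀ t < m * f, x.getD (p + t) false = (array f m v).getD t false) {i : ℕ} (hi : i < m) :
    readBits x (p + i * f) f = v i % 2 ^ f := by
  apply readBits_eq_mod
  intro t ht
  rw [add_assoc, h _ ?_, getD_array v hi ht]
  calc i * f + t < (i + 1) * f := by rw [add_mul]; omega
    _ ≤ m * f := Nat.mul_le_mul_right _ hi

end WordRAM

/-! ### Gap codes of hub sets: unique decoding and length. -/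

namespace DistLabel

open WordRAM

/-- A self-delimiting code for bit strings. -/
def encBits : List Bool → List Bool
  | [] => [false]
  | b :: l => true :: b :: encBits l

theorem length_encBits (l : List Bool) : (encBits l).length = 2 * l.length + 1 := by
  induction l with
  | nil => rfl
  | cons b l ih => simp [encBits, ih]; ring

theorem encBits_append_inj {l l' x y : List Bool} (h : encBits l ++ x = encBits l' ++ y) :
    l = l' ∧ x = y := by
  induction l generalizing l' with
  | nil =>
    cases l' with
    | nil => simpa [encBits] using h
    | cons b l' => simp [encBits] at h
  | cons a l ih =>
    cases l' with
    | nil => simp [encBits] at h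
    | cons b l' =>
      simp only [encBits, List.cons_append, List.cons.injEq, true_and] at h
      obtain ⟨h1, h2⟩ := ih h.2
      exact ⟨by rw [h.1, h1], h2⟩

/-- A self-delimiting code for lists of pairs of numbers. -/
def encPairs : List (ℕ × ℕ) → List Bool
  | [] => [false]
  | a :: l => true :: (encBits a.1.bits ++ (encBits a.2.bits ++ encPairs l))

theorem bits_injective : Function.Injective Nat.bits := fun a b h =>
  Nat.digits.injective 2 (by simp only [Nat.digits_two_eq_bits, h])

theorem encPairs_append_inj {l l' : List (ℕ × ℕ)} {x y : List Bool}
    (h : encPairs l ++ x = encPairs l' ++ y) : l = l' := by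
  induction l generalizing l' with
  | nil =>
    cases l' with
    | nil => rfl
    | cons b l' => simp [encPairs] at h
  | cons a l ih =>
    cases l' with
    | nil => simp [encPairs] at h
    | cons b l' =>
      simp only [encPairs, List.cons_append, List.cons.injEq, true_and, List.append_assoc] at h
      obtain ⟨h1, h⟩ := encBits_append_inj h
      obtain ⟨h2, h⟩ := encBits_append_inj h
      have e1 : a.1 = b.1 := bits_injective h1
      have e2 : a.2 = b.2 := bits_injective h2
      rw [ih h, Prod.ext e1 e2]

/-- A table index is a block code followed by whatever bits come next in the label. Since the code
is prefix-free, these bits do not influence the decoded list. -/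
theorem encPairs_inj_of_prefix {l l' : List (ℕ × ℕ)} {x : List Bool} (h : encPairs l <+: x)
    (h' : encPairs l' <+: x) : l = l' := by
  obtain ⟨y, hy⟩ := h
  obtain ⟨y', hy'⟩ := h'
  exact encPairs_append_inj (hy.trans hy'.symm)

/-- The hubs among the positions `i, …, i + m - 1`, described by the gaps between them and by the
increments of `e` along these gaps (shifted to be nonnegative for a `3`-Lipschitz `e`). -/
def gaps (H : Finset ℕ) (e : ℕ → ℕ) : ℕ → ℕ → ℕ → List (ℕ × ℕ)
  | _, _, 0 => []
  | prev, i, m + 1 =>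
    if i ∈ H then (i - prev, e i + 3 * (i - prev) - e prev) :: gaps H e i (i + 1) m
    else gaps H e prev (i + 1) m

/-- The inverse of `gaps`: the value at a position, plus one, or zero if there is no hub. -/
def decode : List (ℕ × ℕ) → ℕ → ℕ → ℕ → ℕ
  | [], _, _, _ => 0
  | a :: l, p, d, off =>
    if p + a.1 = off then d + a.2 - 3 * a.1 + 1 else decode l (p + a.1) (d + a.2 - 3 * a.1) off

/-- Consecutive values differ by at most three. -/
def SlowlyVarying (e : ℕ → ℕ) : Prop := ∀ i, e (i + 1) ≤ e i + 3 ∧ e i ≤ e (i + 1) + 3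

theorem SlowlyVarying.le {e : ℕ → ℕ} (he : SlowlyVarying e) {i j : ℕ} (h : i ≤ j) :
    e j ≤ e i + 3 * (j - i) ∧ e i ≤ e j + 3 * (j - i) := by
  induction j, h using Nat.le_induction with
  | base => simp
  | succ j hj ih =>
    have := he j
    omega

/-- Invariant: `p` is the previous position relative to the block start `b`, and `d` is `e prev - e
b`, shifted by `3 * s` to be a natural number. A hub yields `e x - e b + 3 * s + 1`, which is
positive; zero thus remains free for "no hub". -/
theorem decode_gaps {H : Finset ℕ} {e : ℕ → ℕ} (he : SlowlyVarying e) {s b x : ℕ} (m : ℕ) :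
    ∀ {prev i p d : ℕ}, b ≤ prev → prev ≤ i → i + m ≤ b + s → p + b = prev →
      d + e b = e prev + 3 * s → i ≤ x → x < i + m →
      (x ∈ H → decode (gaps H e prev i m) p d (x - b) + e b = e x + 3 * s + 1) ∧
      (x ∉ H → decode (gaps H e prev i m) p d (x - b) = 0) := by
  -- Once the scan has passed `x`, all later hub positions are larger and none matches.
  have hnone : ∀ (m : ℕ) {prev i p d : ℕ}, p + b = prev → prev ≤ i → x < i → b ≤ x →
      decode (gaps H e prev i m) p d (x - b) = 0 := by
    intro m
    induction m with
    | zero => intros; rfl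
    | succ m ih =>
      intro prev i p d h1 h2 h3 h4
      rw [gaps]
      split_ifs with hi
      · rw [decode]
        rw [if_neg (by dsimp only; omega)]
        exact ih (by dsimp only; omega) (by omega) (by omega) h4
      · exact ih h1 (by omega) (by omega) h4
  induction m with
  | zero => intros; omega
  | succ m ih =>
    intro prev i p d h1 h2 h3 h4 h5 h6 h7
    have e1 := he.le h2
    have e2 := he.le (h1.trans h2)
    rw [gaps]
    by_cases hi : i ∈ H
    · rw [if_pos hi, decode]
      dsimp only
      by_cases hxi : x = i
      · subst hxi
        rw [if_pos (by omega)]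
        exact ⟨fun _ => by omega, fun h => absurd hi h⟩
      · rw [if_neg (by omega)]
        exact ih (by omega) (by omega) (by omega) (by omega) (by omega) (by omega) (by omega)
    · rw [if_neg hi]
      by_cases hxi : x = i
      · subst hxi
        exact ⟨fun h => absurd h hi, fun _ => hnone m h4 (by omega) (by omega) (by omega)⟩
      · exact ih h1 (by omega) (by omega) h4 h5 (by omega) (by omega)

/-- This is `log g ≤ log r + g / r`, multiplied by `r` to stay in the integers. Summed over the gaps
it gives `log r` per hub plus the total length divided by `r`, so no concavity argument is needed.
-/
theorem mul_size_le {r : ℕ} (hr : 1 ≤ r) (g : ℕ) : r * g.size ≤ r * r.size + g := by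
  have h1 : g < r * (g / r + 1) := Nat.lt_mul_div_succ g hr
  have h2 : g < 2 ^ (r.size + g / r) := by
    rw [pow_add]
    exact h1.trans_le (Nat.mul_le_mul r.lt_size_self.le (Nat.lt_two_pow_self (n := g / r)))
  have h3 := Nat.mul_le_mul_left r (Nat.size_le.2 h2)
  have h4 := Nat.mul_div_le g r
  rw [mul_add] at h3
  omega

theorem size_le_self (g : ℕ) : g.size ≤ g := Nat.size_le.2 Nat.lt_two_pow_self

theorem length_encPairs_gaps_cons {e : ℕ → ℕ} (he : SlowlyVarying e) {prev i : ℕ} (h : prev ≤ i)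
    (l : List (ℕ × ℕ)) :
    (encPairs ((i - prev, e i + 3 * (i - prev) - e prev) :: l)).length ≤
      9 + 4 * (i - prev).size + (encPairs l).length := by
  have h1 := (he.le h).1
  -- The shifted increment is at most 6 times the gap, so it has at most three more digits. With `σ`
  -- the size of the gap, the pair takes `1 + (2σ + 1) + (2(σ + 3) + 1) = 9 + 4σ` bits.
  have h2 : (e i + 3 * (i - prev) - e prev).size ≤ (i - prev).size + 3 := by
    rw [Nat.size_le, pow_add]
    have := (i - prev).lt_size_self
    omega
  simp only [encPairs, List.length_cons, List.length_append, length_encBits, Nat.size_eq_bits_len]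
  omega

/-- The worst case, by `size g ≤ g`: however many hubs a block has, its code takes at most `1 + 13 *
s ≤ 16 * s` bits. This allows table indices of `16 * s` bits. -/
theorem length_encPairs_gaps_le {H : Finset ℕ} {e : ℕ → ℕ} (he : SlowlyVarying e) (m : ℕ) :
    ∀ {prev i : ℕ}, prev ≤ i →
      (encPairs (gaps H e prev i m)).length ≤ 1 + 13 * m + 4 * (i - prev) := by
  induction m with
  | zero => intros; simp [gaps, encPairs]
  | succ m ih =>
    intro prev i h
    rw [gaps]
    split_ifs with hi
    · have h1 := length_encPairs_gaps_cons he h (gaps H e i (i + 1) m)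
      have h2 := ih (show i ≤ i + 1 by omega)
      have h3 := size_le_self (i - prev)
      omega
    · have := ih (show prev ≤ i + 1 by omega)
      omega

/-- The amortised bound: every hub pays `9 + 4 log r` bits, and the remaining terms, proportional to
gap divided by `r`, telescope. -/
theorem mul_length_encPairs_gaps_le {H : Finset ℕ} {e : ℕ → ℕ} (he : SlowlyVarying e) {r : ℕ}
    (hr : 1 ≤ r) (m : ℕ) : ∀ {prev i : ℕ}, prev ≤ i →
      r * (encPairs (gaps H e prev i m)).length ≤
        r * (1 + (H ∩ Finset.Ico i (i + m)).card * (9 + 4 * r.size)) + 4 * (m + (i - prev)) := by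
  induction m with
  | zero => intros; simp [gaps, encPairs]
  | succ m ih =>
    intro prev i h
    have hI : Finset.Ico i (i + (m + 1)) = insert i (Finset.Ico (i + 1) (i + 1 + m)) := by
      rw [Finset.insert_Ico_add_one_left_eq_Ico (by omega)]
      congr 1
      omega
    rw [gaps, hI]
    split_ifs with hi
    · have h1 := Nat.mul_le_mul_left r (length_encPairs_gaps_cons he h (gaps H e i (i + 1) m))
      have h2 := ih (show i ≤ i + 1 by omega)
      have h3 := mul_size_le hr (i - prev)
      rw [Finset.inter_insert_of_mem hi, Finset.card_insert_of_notMem (by simp)]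
      have h4 : i + 1 - i = 1 := by omega
      rw [h4] at h2
      nlinarith
    · have h1 := ih (show prev ≤ i + 1 by omega)
      rw [Finset.inter_insert_of_notMem hi]
      have h4 : i + 1 - prev = i - prev + 1 := by omega
      rw [h4] at h1
      linarith

/-- The number that a block code, extended to `16 * s` bits, stores for the position `off`. -/
noncomputable def tableValue (s code off : ℕ) : ℕ :=
  open Classical in
  if h : ∃ l, encPairs l <+: bitsOf (16 * s) code then decode h.choose 0 (3 * s) off else 0

theorem tableValue_eq {s code : ℕ} {l : List (ℕ × ℕ)} (h : encPairs l <+: bitsOf (16 * s) code)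
    (off : ℕ) : tableValue s code off = decode l 0 (3 * s) off := by
  have hex : ∃ l, encPairs l <+: bitsOf (16 * s) code := ⟨l, h⟩
  rw [tableValue, dif_pos hex, encPairs_inj_of_prefix h hex.choose_spec]

end DistLabel

namespace DistLabel

open WordRAM

/-! ### Reading the hub table of a label -/

section Lookup

variable (w : ℕ) (L : List Bool)

/-- The `j`-th word of a label. The first twelve words form its header. -/
def word (j : ℕ) : ℕ := readBits L (j * w) w

/-- The position of the code of the block that contains position `x`. -/
def codePos (x : ℕ) : ℕ :=
  readBits L (word w L 4 + x / word w L 2 * word w L 0) w +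
    readBits L (word w L 6 + x / word w L 3 * word w L 8) (word w L 8)

/-- The index of the table entry for the position `x`. -/
def tableIndex (x : ℕ) : ℕ :=
  readBits L (codePos w L x) (word w L 9) * word w L 3 + x % word w L 3

/-- The table entry for the position `x`; it is zero if there is no hub at `x`. -/
def mark (x : ℕ) : ℕ :=
  readBits L (word w L 10 + tableIndex w L x * word w L 8) (word w L 8)

/-- The distance stored for the position `x`, up to a constant. -/
def shiftedDist (x : ℕ) : ℕ :=
  mark w L x + readBits L (word w L 5 + x / word w L 2 * word w L 0) w +
    readBits L (word w L 7 + x / word w L 3 * word w L 8) (word w L 8)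

/-- The distance stored in a label for the vertex with number `x`, if this vertex is a hub. -/
def lookup (x : ℕ) : Option ℕ :=
  if mark w L x = 0 then none else some (shiftedDist w L x - word w L 11)

/-- The conditions under which `lookup`, followed by the addition of `d`, can be carried out with
`w`-bit words. -/
structure NoOverflow (x d : ℕ) : Prop where
  word_zero : word w L 0 = w
  width_le : word w L 8 ≤ w
  code_le : word w L 9 ≤ w
  pos₁ : word w L 4 + x / word w L 2 * w < 2 ^ w
  pos₂ : word w L 5 + x / word w L 2 * w < 2 ^ w
  pos₃ : word w L 6 + x / word w L 3 * word w L 8 < 2 ^ w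
  pos₄ : word w L 7 + x / word w L 3 * word w L 8 < 2 ^ w
  pos₅ : codePos w L x < 2 ^ w
  index : tableIndex w L x < 2 ^ w
  pos₆ : word w L 10 + tableIndex w L x * word w L 8 < 2 ^ w
  total : shiftedDist w L x + d < 2 ^ w
  offset : mark w L x ≠ 0 → word w L 11 ≤ shiftedDist w L x

end Lookup

/-! ### The labels -/

/-- The data stored in a label: `H` is the set of the numbers of the hubs, `e` gives their
distances, and `cand` lists numbers of vertices with their distances. The positions are divided
into blocks of length `s`, and `q` blocks form a superblock. -/
structure LabelData where
  (n s q f w : ℕ)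
  (H : Finset ℕ)
  (e : ℕ → ℕ)
  (cand : List (ℕ × ℕ))

namespace LabelData

variable (D : LabelData)

def blocks : ℕ := D.n / D.s + 1

def superblocks : ℕ := D.n / (D.s * D.q) + 1

def blockCode (b : ℕ) : List Bool := encPairs (gaps D.H D.e (b * D.s) (b * D.s) D.s)

def pointer (b : ℕ) : ℕ := ∑ j ∈ Finset.range b, (D.blockCode j).length

def sectionLength : ℕ → ℕ
  | 0 => 12 * D.w
  | 1 => 2 * D.cand.length * D.w
  | 2 => D.superblocks * D.w
  | 3 => D.superblocks * D.w
  | 4 => D.blocks * D.f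
  | 5 => D.blocks * D.f
  | 6 => D.pointer D.blocks
  | 7 => 2 ^ (16 * D.s) * D.s * D.f
  | _ => D.w + 1

def start (k : ℕ) : ℕ := ∑ j ∈ Finset.range k, D.sectionLength j

/-- The last case, word 11, is the total shift contained in `shiftedDist`: `3 * (s * q)` from
section 5, and `3 * s + 1` from the table. -/
def header : ℕ → ℕ
  | 0 => D.w
  | 1 => D.cand.length
  | 2 => D.s * D.q
  | 3 => D.s
  | 4 => D.start 2
  | 5 => D.start 3
  | 6 => D.start 4
  | 7 => D.start 5
  | 8 => D.f
  | 9 => 16 * D.s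
  | 10 => D.start 7
  | _ => 3 * (D.s * D.q) + 3 * D.s + 1

def candidateWord (i : ℕ) : ℕ :=
  if i % 2 = 0 then (D.cand.getD (i / 2) (0, 0)).1 else (D.cand.getD (i / 2) (0, 0)).2

/-- Sections 2 and 3 give absolute code positions and distances, a full word for each superblock;
sections 4 and 5 give the differences for each block in only `f` bits. Section 6 holds the codes and
section 7 the decoding table. The final zero and `w` ones let a reader of the label recover `w` from
its end. -/
noncomputable def sectionBits : ℕ → List Bool
  | 0 => array D.w 12 D.header
  | 1 => array D.w (2 * D.cand.length) D.candidateWord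
  | 2 => array D.w D.superblocks fun i => D.start 6 + D.pointer (i * D.q)
  | 3 => array D.w D.superblocks fun i => D.e (i * (D.s * D.q))
  | 4 => array D.f D.blocks fun b => D.pointer b - D.pointer (b / D.q * D.q)
  | 5 => array D.f D.blocks fun b =>
      D.e (b * D.s) + 3 * (D.s * D.q) - D.e (b / D.q * (D.s * D.q))
  | 6 => (List.range D.blocks).flatMap D.blockCode
  | 7 => array D.f (2 ^ (16 * D.s) * D.s) fun i => tableValue D.s (i / D.s) (i % D.s)
  | _ => false :: List.replicate D.w true

noncomputable def label : List Bool := (List.range 9).flatMap D.sectionBits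

/-- The numbers that occur fit into the fields provided for them. -/
structure Fits : Prop where
  s_pos : 1 ≤ D.s
  q_pos : 1 ≤ D.q
  slow : SlowlyVarying D.e
  e_le : ∀ i ≤ D.n, D.e i ≤ 3 * D.n
  cand_le : ∀ a ∈ D.cand, a.1 < D.n ∧ a.2 ≤ D.n
  field : 16 * (D.s * D.q) < 2 ^ D.f
  field_le : D.f ≤ D.w
  code_le : 16 * D.s ≤ D.w
  total : D.start 9 + 4 * D.n + 7 * (D.s * D.q) < 2 ^ D.w

theorem length_sectionBits (k : ℕ) : (D.sectionBits k).length = D.sectionLength k := by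
  unfold sectionBits sectionLength
  split <;> first | exact length_flatMap_range _ _ | simp

theorem length_label : D.label.length = D.start 9 := by
  rw [label, length_flatMap_range, start]
  exact Finset.sum_congr rfl fun k _ => D.length_sectionBits k

theorem getD_label {k t : ℕ} (hk : k < 9) (ht : t < D.sectionLength k) :
    D.label.getD (D.start k + t) false = (D.sectionBits k).getD t false := by
  rw [← length_sectionBits] at ht
  rw [label, ← getD_flatMap_range D.sectionBits hk ht, start]
  simp only [length_sectionBits]

theorem start_succ (k : ℕ) : D.start (k + 1) = D.start k + D.sectionLength k :=
  Finset.sum_range_succ _ _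

theorem start_mono {k l : ℕ} (h : k ≤ l) : D.start k ≤ D.start l :=
  Finset.sum_le_sum_of_subset (Finset.range_subset_range.2 h)

theorem readBits_label {k f m : ℕ} {v : ℕ → ℕ} (hk : k < 9) (hlen : D.sectionLength k = m * f)
    (hs : D.sectionBits k = array f m v) {i : ℕ} (hi : i < m) :
    readBits D.label (D.start k + i * f) f = v i % 2 ^ f := by
  refine readBits_of_array (fun t ht => ?_) hi
  rw [D.getD_label hk (hlen ▸ ht), hs]

variable {D}

theorem pointer_mono {a b : ℕ} (h : a ≤ b) : D.pointer a ≤ D.pointer b :=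
  Finset.sum_le_sum_of_subset (Finset.range_subset_range.2 h)

theorem length_blockCode_le (hD : D.Fits) (b : ℕ) : (D.blockCode b).length ≤ 1 + 13 * D.s := by
  rw [blockCode]
  simpa using length_encPairs_gaps_le (H := D.H) hD.slow D.s (le_refl (b * D.s))

theorem pointer_sub_le (hD : D.Fits) {a b : ℕ} (h : a ≤ b) :
    D.pointer b - D.pointer a ≤ (b - a) * (1 + 13 * D.s) := by
  rw [pointer, pointer, ← Finset.sum_range_add_sum_Ico _ h, Nat.add_sub_cancel_left]
  simpa using Finset.sum_le_card_nsmul (Finset.Ico a b) _ _ fun b _ => length_blockCode_le hD b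

theorem header_lt (hD : D.Fits) (j : ℕ) : D.header j < 2 ^ D.w := by
  have h1 := hD.total
  have h2 : D.w < 2 ^ D.w := Nat.lt_two_pow_self
  have h3 : D.s ≤ D.s * D.q := Nat.le_mul_of_pos_right _ hD.q_pos
  have h4 := hD.field_le
  have h5 := hD.code_le
  have h6 := hD.s_pos
  have st : ∀ k ≤ 9, D.start k ≤ D.start 9 := fun k hk => D.start_mono hk
  have h7 : D.cand.length ≤ D.start 9 := by
    have : D.start 2 = D.start 1 + _ := D.start_succ 1
    have h8 := st 2 (by norm_num)
    have h9 : D.cand.length ≤ D.sectionLength 1 := by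
      rw [sectionLength]
      have : 1 ≤ D.w := by omega
      nlinarith
    omega
  have := st 2 (by norm_num)
  have := st 3 (by norm_num)
  have := st 4 (by norm_num)
  have := st 5 (by norm_num)
  have := st 7 (by norm_num)
  unfold header
  split <;> omega

theorem word_label (hD : D.Fits) {j : ℕ} (hj : j < 12) : word D.w D.label j = D.header j := by
  have := D.readBits_label (k := 0) (by norm_num) rfl rfl hj
  rw [start, Finset.sum_range_zero, zero_add] at this
  rw [word, this, Nat.mod_eq_of_lt (header_lt hD j)]

theorem word_label_candidate (hD : D.Fits) {i : ℕ} (hi : i < 2 * D.cand.length) :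
    word D.w D.label (12 + i) = D.candidateWord i := by
  have := D.readBits_label (k := 1) (by norm_num) rfl rfl hi
  rw [D.start_succ 0, start, Finset.sum_range_zero, zero_add, sectionLength, ← add_mul] at this
  rw [word, this, Nat.mod_eq_of_lt]
  have h1 := hD.total
  obtain ⟨h2, h3⟩ := hD.cand_le (D.cand.getD (i / 2) (0, 0)) (by
    rw [List.getD_eq_getElem _ _ (by omega)]
    exact List.getElem_mem _)
  unfold candidateWord
  split <;> omega

/-- The read has fixed length and may run on into later codes or into the table; only its beginning
is known, and that suffices. -/
theorem blockCode_prefix (hD : D.Fits) {b : ℕ} (hb : b < D.blocks) :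
    D.blockCode b <+:
      bitsOf (16 * D.s) (readBits D.label (D.start 6 + D.pointer b) (16 * D.s)) := by
  rw [bitsOf_readBits]
  have hlen := length_blockCode_le hD b
  have hs := hD.s_pos
  rw [List.prefix_iff_eq_take]
  apply List.ext_getElem
  · simp; omega
  intro t h1 h2
  rw [List.getElem_take, List.getElem_map, List.getElem_range, add_assoc, D.getD_label (by norm_num),
    sectionBits, pointer, getD_flatMap_range _ hb h1, List.getD_eq_getElem _ _ h1]
  calc D.pointer b + t < D.pointer (b + 1) := by
        rw [pointer, pointer, Finset.sum_range_succ]; omega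
    _ ≤ D.pointer D.blocks := pointer_mono hb

variable {x : ℕ}

theorem blockCode_decode (hD : D.Fits) :
    (x ∈ D.H → decode (gaps D.H D.e (x / D.s * D.s) (x / D.s * D.s) D.s) 0 (3 * D.s) (x % D.s) +
      D.e (x / D.s * D.s) = D.e x + 3 * D.s + 1) ∧
    (x ∉ D.H →
      decode (gaps D.H D.e (x / D.s * D.s) (x / D.s * D.s) D.s) 0 (3 * D.s) (x % D.s) = 0) := by
  have h1 := Nat.div_add_mod' x D.s
  have h2 := Nat.mod_lt x hD.s_pos
  have h3 := decode_gaps (H := D.H) hD.slow (s := D.s) (b := x / D.s * D.s) (x := x) D.s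
    (prev := x / D.s * D.s) (i := x / D.s * D.s) (p := 0) (d := 3 * D.s) le_rfl le_rfl le_rfl
    (zero_add _) (add_comm _ _) (by omega) (by omega)
  rwa [show x - x / D.s * D.s = x % D.s by omega] at h3

theorem block_lt (hx : x < D.n) : x / D.s < D.blocks :=
  Nat.lt_succ_of_le (Nat.div_le_div_right hx.le)

theorem superblock_lt (hx : x < D.n) : x / (D.s * D.q) < D.superblocks :=
  Nat.lt_succ_of_le (Nat.div_le_div_right hx.le)

theorem codePos_label (hD : D.Fits) (hx : x < D.n) :
    codePos D.w D.label x = D.start 6 + D.pointer (x / D.s) := by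
  have hw := fun j hj => word_label hD (j := j) hj
  rw [codePos, hw 0 (by norm_num), hw 2 (by norm_num), hw 3 (by norm_num), hw 4 (by norm_num),
    hw 6 (by norm_num), hw 8 (by norm_num)]
  simp only [header]
  rw [D.readBits_label (k := 2) (by norm_num) rfl rfl (superblock_lt hx),
    D.readBits_label (k := 4) (by norm_num) rfl rfl (block_lt hx), ← Nat.div_div_eq_div_mul]
  have h1 := Nat.div_add_mod' (x / D.s) D.q
  have h2 := Nat.mod_lt (x / D.s) hD.q_pos
  have hle : x / D.s / D.q * D.q ≤ x / D.s := Nat.div_mul_le_self _ _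
  have h3 := pointer_sub_le hD hle
  have h4 := pointer_mono (D := D) hle
  have h5 := pointer_mono (D := D) (block_lt hx).le
  have h6 : D.start 6 + D.pointer D.blocks ≤ D.start 9 := by
    rw [show D.pointer D.blocks = D.sectionLength 6 from rfl, ← start_succ]
    exact D.start_mono (by norm_num)
  have h7 := hD.total
  have h8 : (x / D.s - x / D.s / D.q * D.q) * (1 + 13 * D.s) ≤ D.q * (16 * D.s) :=
    Nat.mul_le_mul (by omega) (by have := hD.s_pos; omega)
  have h9 := hD.field
  have h10 : D.q * (16 * D.s) = 16 * (D.s * D.q) := by ring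
  rw [Nat.mod_eq_of_lt (by omega), Nat.mod_eq_of_lt (by omega)]
  omega

theorem tableIndex_label (hD : D.Fits) (hx : x < D.n) :
    tableIndex D.w D.label x =
      readBits D.label (D.start 6 + D.pointer (x / D.s)) (16 * D.s) * D.s + x % D.s := by
  rw [tableIndex, codePos_label hD hx, word_label hD (by norm_num), word_label hD (by norm_num)]
  rfl

theorem tableIndex_lt (hD : D.Fits) (hx : x < D.n) :
    tableIndex D.w D.label x < 2 ^ (16 * D.s) * D.s := by
  rw [tableIndex_label hD hx]
  calc _ < (readBits D.label (D.start 6 + D.pointer (x / D.s)) (16 * D.s) + 1) * D.s := by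
        have := Nat.mod_lt x hD.s_pos
        rw [add_mul]; omega
    _ ≤ _ := Nat.mul_le_mul_right _ (readBits_lt _ _ _)

theorem mark_label (hD : D.Fits) (hx : x < D.n) :
    (x ∈ D.H → mark D.w D.label x + D.e (x / D.s * D.s) = D.e x + 3 * D.s + 1) ∧
      (x ∉ D.H → mark D.w D.label x = 0) := by
  have h := blockCode_decode (x := x) hD
  have hmod := Nat.mod_lt x hD.s_pos
  rw [mark, word_label hD (by norm_num), word_label hD (by norm_num)]
  simp only [header]
  rw [D.readBits_label (k := 7) (by norm_num) rfl rfl (tableIndex_lt hD hx), tableIndex_label hD hx,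
    mul_comm _ D.s, Nat.mul_add_div hD.s_pos, Nat.mul_add_mod, Nat.mod_mod, Nat.div_eq_of_lt hmod,
    add_zero, tableValue_eq (blockCode_prefix hD (block_lt hx))]
  refine ⟨fun hH => ?_, fun hH => by rw [h.2 hH, Nat.zero_mod]⟩
  have h1 := h.1 hH
  have h2 := Nat.div_add_mod' x D.s
  have h3 := (hD.slow.le (show x / D.s * D.s ≤ x by omega)).1
  have h4 := hD.field
  have h5 : D.s ≤ D.s * D.q := Nat.le_mul_of_pos_right _ hD.q_pos
  rw [Nat.mod_eq_of_lt (by omega), h1]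

theorem shiftedDist_label (hD : D.Fits) (hx : x < D.n) :
    shiftedDist D.w D.label x = mark D.w D.label x + D.e (x / D.s * D.s) + 3 * (D.s * D.q) := by
  have hw := fun j hj => word_label hD (j := j) hj
  rw [shiftedDist, hw 0 (by norm_num), hw 2 (by norm_num), hw 3 (by norm_num), hw 5 (by norm_num),
    hw 7 (by norm_num), hw 8 (by norm_num)]
  simp only [header]
  rw [D.readBits_label (k := 3) (by norm_num) rfl rfl (superblock_lt hx),
    D.readBits_label (k := 5) (by norm_num) rfl rfl (block_lt hx), ← Nat.div_div_eq_div_mul]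
  have hle : x / D.s / D.q * (D.s * D.q) ≤ x / D.s * D.s := by
    rw [mul_comm D.s, ← mul_assoc]
    exact Nat.mul_le_mul_right _ (Nat.div_mul_le_self _ _)
  have hle' : x / D.s * D.s ≤ x := Nat.div_mul_le_self _ _
  have hlt : x / D.s * D.s < x / D.s / D.q * (D.s * D.q) + D.s * D.q := by
    have := Nat.lt_div_mul_add (a := x / D.s) hD.q_pos
    calc x / D.s * D.s < (x / D.s / D.q * D.q + D.q) * D.s :=
          Nat.mul_lt_mul_of_pos_right this hD.s_pos
      _ = _ := by ring
  have h1 := hD.slow.le hle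
  have h2 := hD.e_le (x / D.s / D.q * (D.s * D.q)) (by omega)
  have h3 := hD.total
  have h4 := hD.field
  rw [Nat.mod_eq_of_lt (by omega), Nat.mod_eq_of_lt (by omega)]
  omega

theorem shiftedDist_label_of_mem (hD : D.Fits) (hx : x < D.n) (hH : x ∈ D.H) :
    shiftedDist D.w D.label x = D.e x + word D.w D.label 11 := by
  rw [shiftedDist_label hD hx, (mark_label hD hx).1 hH, word_label hD (by norm_num), header]
  all_goals omega

/-- At the block start `e` exceeds `e x` by at most `3 * s`, so the added 1 makes the mark of a hub
positive. -/
theorem mark_label_eq_zero_iff (hD : D.Fits) (hx : x < D.n) :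
    mark D.w D.label x = 0 ↔ x ∉ D.H := by
  refine ⟨fun h hH => ?_, (mark_label hD hx).2⟩
  have h1 := (mark_label hD hx).1 hH
  have h2 : x / D.s * D.s ≤ x := Nat.div_mul_le_self _ _
  have h3 := (hD.slow.le h2).2
  have h4 := Nat.div_add_mod' x D.s
  have h5 := Nat.mod_lt x hD.s_pos
  omega

theorem lookup_label (hD : D.Fits) (hx : x < D.n) (d : ℕ) :
    lookup D.w D.label x = some d ↔ x ∈ D.H ∧ D.e x = d := by
  rw [lookup]
  by_cases hH : x ∈ D.H
  · rw [if_neg (by rw [mark_label_eq_zero_iff hD hx]; simpa using hH),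
      shiftedDist_label_of_mem hD hx hH]
    simp [hH]
  · rw [if_pos ((mark_label_eq_zero_iff hD hx).2 hH)]
    simp [hH]

theorem noOverflow_label (hD : D.Fits) (hx : x < D.n) {d : ℕ} (hd : d ≤ D.n) :
    NoOverflow D.w D.label x d := by
  have hw := fun j hj => word_label hD (j := j) hj
  have htot := hD.total
  have hf : 1 ≤ D.f := by
    rcases Nat.eq_zero_or_pos D.f with h | h
    · have h1 := hD.field
      have h2 : 1 ≤ D.s * D.q := Nat.mul_pos hD.s_pos hD.q_pos
      rw [h] at h1
      omega
    · exact h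
  have hpos : ∀ {k m g i : ℕ}, k < 9 → D.sectionLength k = m * g → i < m →
      D.start k + i * g < 2 ^ D.w := by
    intro k m g i hk hlen hi
    have h1 := D.start_succ k
    have h2 : D.start (k + 1) ≤ _ := D.start_mono hk
    have h3 : i * g ≤ m * g := Nat.mul_le_mul_right _ hi.le
    omega
  have hidx := tableIndex_lt hD hx
  have hsd := shiftedDist_label hD hx
  have hmk := mark_label hD hx
  have hs : D.s ≤ D.s * D.q := Nat.le_mul_of_pos_right _ hD.q_pos
  have hle : x / D.s * D.s ≤ x := Nat.div_mul_le_self _ _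
  have hxe := hD.e_le x hx.le
  have hbe := hD.e_le (x / D.s * D.s) (by omega)
  refine ⟨hw 0 (by norm_num), ?_, ?_, ?_, ?_, ?_, ?_, ?_, ?_, ?_, ?_, ?_⟩
  · rw [hw 8 (by norm_num)]
    exact hD.field_le
  · rw [hw 9 (by norm_num)]
    exact hD.code_le
  · rw [hw 4 (by norm_num), hw 2 (by norm_num)]
    exact hpos (k := 2) (by norm_num) rfl (superblock_lt hx)
  · rw [hw 5 (by norm_num), hw 2 (by norm_num)]
    exact hpos (k := 3) (by norm_num) rfl (superblock_lt hx)
  · rw [hw 6 (by norm_num), hw 3 (by norm_num), hw 8 (by norm_num)]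
    exact hpos (k := 4) (by norm_num) rfl (block_lt hx)
  · rw [hw 7 (by norm_num), hw 3 (by norm_num), hw 8 (by norm_num)]
    exact hpos (k := 5) (by norm_num) rfl (block_lt hx)
  · rw [codePos_label hD hx]
    have h1 : D.pointer (x / D.s) ≤ D.sectionLength 6 := pointer_mono (block_lt hx).le
    have h2 : D.start 7 = D.start 6 + _ := D.start_succ 6
    have h3 := D.start_mono (show 7 ≤ 9 by norm_num)
    omega
  · have h1 : 2 ^ (16 * D.s) * D.s ≤ D.sectionLength 7 := Nat.le_mul_of_pos_right _ hf
    have h2 : D.start 8 = D.start 7 + _ := D.start_succ 7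
    have h3 := D.start_mono (show 8 ≤ 9 by norm_num)
    omega
  · rw [hw 10 (by norm_num), hw 8 (by norm_num)]
    exact hpos (k := 7) (by norm_num) rfl hidx
  · by_cases hH : x ∈ D.H
    · have := hmk.1 hH
      have := hD.s_pos
      omega
    · have := hmk.2 hH
      omega
  · intro h
    have hH : x ∈ D.H := by
      by_contra hH
      exact h (hmk.2 hH)
    rw [shiftedDist_label_of_mem hD hx hH]
    omega

/-- The word size can be read off from the end of a label. -/
theorem wordSize_label : (D.label.reverse.takeWhile id).length = D.w := by
  rw [label, show 9 = 8 + 1 from rfl, List.range_succ, List.flatMap_append, List.flatMap_singleton,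
    List.reverse_append, show D.sectionBits 8 = false :: List.replicate D.w true from rfl]
  simp

end LabelData

end DistLabel

/-! ### The decoder and its step-by-step execution; the memory stays zero throughout. -/

namespace WordRAM

/-- The instructions at the beginning of the decoder: they load the constant `1`, the largest
word, the word size, the number of candidates in the second label and ten words of the header of
the first label. -/
def prologue : List Instr :=
  -- Register 2 becomes `0 - 1 = 2 ^ w - 1`. A request for that many bits is cut down to one word,
  -- so the program learns `w` from word 0 of the label.
  [.const 1 1, .op .sub 2 0 1, .read false 3 0 2, .read true 5 3 2, .op .add 4 3 3,
   .read false 12 4 2, .op .add 4 4 3, .read false 13 4 2, .op .add 4 4 3,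
   .read false 14 4 2, .op .add 4 4 3, .read false 15 4 2, .op .add 4 4 3,
   .read false 16 4 2, .op .add 4 4 3, .read false 17 4 2, .op .add 4 4 3,
   .read false 18 4 2, .op .add 4 4 3, .read false 19 4 2, .op .add 4 4 3,
   .read false 20 4 2, .op .add 4 4 3, .read false 21 4 2, .op .add 4 4 3,
   .op .add 8 2 0]

/-- The program that computes a distance from two labels: for every candidate `x` of the second
label it looks up the distance of `x` in the first label, and it outputs the smallest sum. -/
def decoder : List Instr := prologue ++
  -- Instruction 26, the head of the loop. On exit 1 is added, so the initial minimum `2 ^ w - 1`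
  -- wraps around to 0, the code of `∞`.
  [.jumpLt 7 5 29, .op .add 8 8 1, .halt 8,
   .read true 9 4 3, .op .add 4 4 3, .read true 22 4 3, .op .add 4 4 3, .op .add 7 7 1,
   .op .div 23 9 12, .op .mul 23 23 3, .op .add 24 14 23, .read false 24 24 3,
   .op .add 25 15 23, .read false 25 25 3,
   .op .div 23 9 13, .op .mul 23 23 18, .op .add 26 16 23, .read false 26 26 18,
   .op .add 27 17 23, .read false 27 27 18,
   .op .add 24 24 26, .read false 24 24 19, .op .mul 24 24 13, .op .mod 23 9 13,
   .op .add 24 24 23, .op .mul 24 24 18, .op .add 24 24 20, .read false 24 24 18,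
   -- A mark below 1 means that the candidate is not a hub. The jump on `0 < 1` at the end is
   -- unconditional.
   .jumpLt 24 1 26, .op .add 24 24 25, .op .add 24 24 27, .op .add 24 24 22, .op .sub 24 24 21,
   .jumpLt 8 24 26, .op .add 8 24 0, .jumpLt 0 1 26]

section

variable {w : ℕ} {P : List Instr} {x y : List Bool} {t pc : ℕ} {reg mem : ℕ → ℕ}

theorem run_const {i a : ℕ} (h : P[pc]? = some (.const i a)) :
    run w P x y (t + 1) ⟨pc, reg, mem⟩ =
      run w P x y t ⟨pc + 1, Function.update reg i (a % 2 ^ w), mem⟩ := by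
  simp [run, h, exec, State.set]

theorem run_op {o : Op} {i j k : ℕ} (h : P[pc]? = some (.op o i j k)) :
    run w P x y (t + 1) ⟨pc, reg, mem⟩ =
      run w P x y t ⟨pc + 1, Function.update reg i (o.eval w (reg j) (reg k)), mem⟩ := by
  simp [run, h, exec, State.set]

theorem run_read {b : Bool} {i j k : ℕ} (h : P[pc]? = some (.read b i j k)) :
    run w P x y (t + 1) ⟨pc, reg, mem⟩ = run w P x y t
      ⟨pc + 1, Function.update reg i (readBits (cond b y x) (reg j) (min (reg k) w)), mem⟩ := by
  simp [run, h, exec, State.set]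

theorem run_jumpLt_of_lt {i j l : ℕ} (h : P[pc]? = some (.jumpLt i j l)) (hlt : reg i < reg j) :
    run w P x y (t + 1) ⟨pc, reg, mem⟩ = run w P x y t ⟨l, reg, mem⟩ := by
  simp [run, h, exec, hlt]

theorem run_jumpLt_of_le {i j l : ℕ} (h : P[pc]? = some (.jumpLt i j l)) (hle : reg j ≤ reg i) :
    run w P x y (t + 1) ⟨pc, reg, mem⟩ = run w P x y t ⟨pc + 1, reg, mem⟩ := by
  simp [run, h, exec, not_lt.2 hle]

theorem run_halt {i : ℕ} (h : P[pc]? = some (.halt i)) :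
    run w P x y (t + 1) ⟨pc, reg, mem⟩ = some (reg i) := by
  simp [run, h]

end

end WordRAM

namespace DistLabel

open WordRAM

/-- The number of the `k`-th candidate of a label. -/
def candName (w : ℕ) (L : List Bool) (k : ℕ) : ℕ := word w L (12 + 2 * k)

/-- The distance of the `k`-th candidate of a label. -/
def candDist (w : ℕ) (L : List Bool) (k : ℕ) : ℕ := word w L (12 + 2 * k + 1)

/-- The smallest sum found among the first `k` candidates. -/
def best (w : ℕ) (L L' : List Bool) : ℕ → ℕ
  | 0 => 2 ^ w - 1
  | k + 1 =>
    if mark w L (candName w L' k) = 0 then best w L L' k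
    else min (best w L L' k)
      (shiftedDist w L (candName w L' k) + candDist w L' k - word w L 11)

/-- The registers that do not change after the prologue. -/
structure Loaded (w : ℕ) (L L' : List Bool) (reg : ℕ → ℕ) : Prop where
  r0 : reg 0 = 0
  r1 : reg 1 = 1
  r3 : reg 3 = w
  r5 : reg 5 = word w L' 1
  r12 : reg 12 = word w L 2
  r13 : reg 13 = word w L 3
  r14 : reg 14 = word w L 4
  r15 : reg 15 = word w L 5
  r16 : reg 16 = word w L 6
  r17 : reg 17 = word w L 7
  r18 : reg 18 = word w L 8
  r19 : reg 19 = word w L 9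
  r20 : reg 20 = word w L 10
  r21 : reg 21 = word w L 11

section

variable {w : ℕ} {L L' : List Bool}

theorem Loaded.congr {reg reg' : ℕ → ℕ} (h : Loaded w L L' reg)
    (h' : ∀ j, j ∈ [0, 1, 3, 5, 12, 13, 14, 15, 16, 17, 18, 19, 20, 21] → reg' j = reg j) :
    Loaded w L L' reg' := by
  constructor
  all_goals rw [h' _ (by decide)]
  exacts [h.r0, h.r1, h.r3, h.r5, h.r12, h.r13, h.r14, h.r15, h.r16, h.r17, h.r18, h.r19, h.r20,
    h.r21]

theorem word_lt (w : ℕ) (L : List Bool) (j : ℕ) : word w L j < 2 ^ w := readBits_lt _ _ _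

/-- A phase of a computation: `k` steps of the decoder. -/
def Leads (w : ℕ) (L L' : List Bool) (k : ℕ) (s s' : State) : Prop :=
  ∀ t, run w decoder L L' (t + k) s = run w decoder L L' t s'

theorem Leads.trans {k l : ℕ} {s s' s'' : State} (h : Leads w L L' k s s')
    (h' : Leads w L L' l s' s'') : Leads w L L' (l + k) s s'' := fun t => by
  rw [← add_assoc, h, h']

/-- One read-and-advance pair of the prologue, to be used ten times. -/
theorem exists_leads_header {reg : ℕ → ℕ} (pc j i : ℕ)
    (r2 : reg 2 = 2 ^ w - 1) (r3 : reg 3 = w) (r4 : reg 4 = j * w) (hj : (j + 1) * w < 2 ^ w)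
    (hi : i ≠ 4 ∧ i ≠ 3) (h1 : decoder[pc]? = some (.read false i 4 2))
    (h2 : decoder[pc + 1]? = some (.op .add 4 4 3)) :
    ∃ reg', Leads w L L' 2 ⟨pc, reg, fun _ => 0⟩ ⟨pc + 2, reg', fun _ => 0⟩ ∧
      reg' i = word w L j ∧ reg' 4 = (j + 1) * w ∧ ∀ k, k ≠ 4 → k ≠ i → reg' k = reg k := by
  refine ⟨Function.update (Function.update reg i (word w L j)) 4 ((j + 1) * w), fun t => ?_, ?_, ?_,
    fun k hk hk' => ?_⟩
  · have hw : w < 2 ^ w := Nat.lt_two_pow_self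
    rw [show t + 2 = t + 1 + 1 from rfl, run_read h1, run_op h2]
    congr 3
    · simp only [r2, r4, word, cond_false]
      rw [min_eq_right (by omega)]
    · rw [Function.update_of_ne hi.1.symm, Function.update_of_ne hi.2.symm, r3, r4, Op.eval,
        ← Nat.succ_mul, Nat.mod_eq_of_lt hj]
  · rw [Function.update_of_ne hi.1, Function.update_self]
  · rw [Function.update_self]
  · rw [Function.update_of_ne hk, Function.update_of_ne hk']

theorem exists_leads_prologue (hw : 1 ≤ w) (h12 : 12 * w < 2 ^ w) (h0 : word w L 0 = w) :
    ∃ reg, Leads w L L' 26 State.init ⟨26, reg, fun _ => 0⟩ ∧ Loaded w L L' reg ∧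
      reg 4 = 12 * w ∧ reg 7 = 0 ∧ reg 8 = 2 ^ w - 1 := by
  have hw2 : w < 2 ^ w := Nat.lt_two_pow_self
  have hmod : (2 ^ w - 1) % 2 ^ w = 2 ^ w - 1 := Nat.mod_eq_of_lt (by omega)
  obtain ⟨reg, hreg, hA⟩ : ∃ reg, Leads w L L' 5 State.init ⟨5, reg, fun _ => 0⟩ ∧
      (reg 0 = 0 ∧ reg 1 = 1 ∧ reg 2 = 2 ^ w - 1 ∧ reg 3 = w ∧ reg 5 = word w L' 1 ∧
        reg 4 = 2 * w ∧ reg 7 = 0) := by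
    refine ⟨Function.update (Function.update (Function.update (Function.update (Function.update
      (fun _ => 0) 1 1) 2 (2 ^ w - 1)) 3 w) 5 (word w L' 1)) 4 (2 * w), fun t => ?_, by simp⟩
    rw [State.init, show t + 5 = t + 1 + 1 + 1 + 1 + 1 from rfl, run_const rfl, run_op rfl,
      run_read rfl, run_read rfl, run_op rfl]
    have h1 : 1 % 2 ^ w = 1 := Nat.mod_eq_of_lt (by omega)
    have h2 : min (2 ^ w - 1) w = w := min_eq_right (by omega)
    have h3 : readBits L 0 w = w := by simpa [word] using h0
    have h4 : (w + w) % 2 ^ w = 2 * w := by rw [← two_mul]; exact Nat.mod_eq_of_lt (by omega)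
    simp [Op.eval, h1, h2, h3, h4, hmod, word]
  obtain ⟨r0, r1, r2, r3, r5, r4, r7⟩ := hA
  obtain ⟨reg1, e1, v1, p1, f1⟩ := exists_leads_header (L := L) (L' := L') 5 2 12
    r2 r3 r4 (by omega) (by decide) rfl rfl
  obtain ⟨reg2, e2, v2, p2, f2⟩ := exists_leads_header (L := L) (L' := L') 7 3 13
    (by simp [f1, r2]) (by simp [f1, r3]) p1 (by omega) (by decide) rfl rfl
  obtain ⟨reg3, e3, v3, p3, f3⟩ := exists_leads_header (L := L) (L' := L') 9 4 14
    (by simp [f1, f2, r2]) (by simp [f1, f2, r3]) p2 (by omega) (by decide) rfl rfl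
  obtain ⟨reg4, e4, v4, p4, f4⟩ := exists_leads_header (L := L) (L' := L') 11 5 15
    (by simp [f1, f2, f3, r2]) (by simp [f1, f2, f3, r3]) p3 (by omega) (by decide) rfl rfl
  obtain ⟨reg5, e5, v5, p5, f5⟩ := exists_leads_header (L := L) (L' := L') 13 6 16
    (by simp [f1, f2, f3, f4, r2]) (by simp [f1, f2, f3, f4, r3]) p4 (by omega) (by decide) rfl rfl
  obtain ⟨reg6, e6, v6, p6, f6⟩ := exists_leads_header (L := L) (L' := L') 15 7 17
    (by simp [f1, f2, f3, f4, f5, r2]) (by simp [f1, f2, f3, f4, f5, r3]) p5 (by omega) (by decide) rfl rfl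
  obtain ⟨reg7, e7, v7, p7, f7⟩ := exists_leads_header (L := L) (L' := L') 17 8 18
    (by simp [f1, f2, f3, f4, f5, f6, r2]) (by simp [f1, f2, f3, f4, f5, f6, r3]) p6 (by omega) (by decide) rfl rfl
  obtain ⟨reg8, e8, v8, p8, f8⟩ := exists_leads_header (L := L) (L' := L') 19 9 19
    (by simp [f1, f2, f3, f4, f5, f6, f7, r2]) (by simp [f1, f2, f3, f4, f5, f6, f7, r3]) p7 (by omega) (by decide) rfl rfl
  obtain ⟨reg9, e9, v9, p9, f9⟩ := exists_leads_header (L := L) (L' := L') 21 10 20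
    (by simp [f1, f2, f3, f4, f5, f6, f7, f8, r2]) (by simp [f1, f2, f3, f4, f5, f6, f7, f8, r3]) p8 (by omega) (by decide) rfl rfl
  obtain ⟨reg10, e10, v10, p10, f10⟩ := exists_leads_header (L := L) (L' := L') 23 11 21
    (by simp [f1, f2, f3, f4, f5, f6, f7, f8, f9, r2]) (by simp [f1, f2, f3, f4, f5, f6, f7, f8, f9, r3]) p9 (by omega) (by decide) rfl rfl
  have e := (((((((((hreg.trans e1).trans e2).trans e3).trans e4).trans e5).trans e6).trans
    e7).trans e8).trans e9).trans e10
  refine ⟨_, fun t => (e (t + 1)).trans (run_op rfl), ?_, ?_, ?_, ?_⟩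
  · constructor <;> simp [f1, f2, f3, f4, f5, f6, f7, f8, f9, f10, v1, v2, v3, v4, v5, v6, v7, v8, v9, v10,
      r0, r1, r3, r5]
  · simp [p10]
  · simp [f1, f2, f3, f4, f5, f6, f7, f8, f9, f10, r7]
  · simp [f1, f2, f3, f4, f5, f6, f7, f8, f9, f10, Op.eval, r0, r2, hmod]

end

end DistLabel

namespace DistLabel

open WordRAM

section

variable {w : ℕ} {L L' : List Bool} {reg : ℕ → ℕ}

theorem exists_leads_candidate {k : ℕ} (hl : Loaded w L L' reg)
    (r4 : reg 4 = (12 + 2 * k) * w) (r7 : reg 7 = k) (hk : k < word w L' 1)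
    (hw : (12 + 2 * k + 2) * w < 2 ^ w) :
    ∃ reg', Leads w L L' 6 ⟨26, reg, fun _ => 0⟩ ⟨34, reg', fun _ => 0⟩ ∧ Loaded w L L' reg' ∧
      reg' 4 = (12 + 2 * (k + 1)) * w ∧ reg' 7 = k + 1 ∧ reg' 8 = reg 8 ∧
      reg' 9 = candName w L' k ∧ reg' 22 = candDist w L' k := by
  have hk' := word_lt w L' 1
  have h1 : ((12 + 2 * k) * w + w) % 2 ^ w = (12 + 2 * k + 1) * w := by
    rw [Nat.mod_eq_of_lt (by nlinarith)]
    ring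
  have h2 : ((12 + 2 * k + 1) * w + w) % 2 ^ w = (12 + 2 * (k + 1)) * w := by
    rw [Nat.mod_eq_of_lt (by nlinarith)]
    ring
  have h3 : (k + 1) % 2 ^ w = k + 1 := Nat.mod_eq_of_lt (by omega)
  refine ⟨Function.update (Function.update (Function.update (Function.update (Function.update
    reg 9 (candName w L' k)) 4 ((12 + 2 * k + 1) * w)) 22 (candDist w L' k)) 4
    ((12 + 2 * (k + 1)) * w)) 7 (k + 1), fun t => ?_, hl.congr ?_, by simp, by simp, by simp,
    by simp, by simp⟩
  · rw [show t + 6 = t + 1 + 1 + 1 + 1 + 1 + 1 from rfl,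
      run_jumpLt_of_lt (i := 7) (j := 5) (l := 29) rfl (by rw [r7, hl.r5]; exact hk), run_read rfl,
      run_op rfl, run_read rfl, run_op rfl, run_op rfl]
    simp [Op.eval, r4, hl.r3, h1, h2, h3, r7, hl.r1, candName, candDist, word]
  · intro j hj
    fin_cases hj <;> simp

theorem exists_leads_superblock {x d : ℕ} (hl : Loaded w L L' reg) (r9 : reg 9 = x)
    (hx : x < 2 ^ w) (hn : NoOverflow w L x d) :
    ∃ reg', Leads w L L' 6 ⟨34, reg, fun _ => 0⟩ ⟨40, reg', fun _ => 0⟩ ∧ Loaded w L L' reg' ∧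
      reg' 24 = readBits L (word w L 4 + x / word w L 2 * w) w ∧
      reg' 25 = readBits L (word w L 5 + x / word w L 2 * w) w ∧
      ∀ j ∈ [4, 7, 8, 9, 22], reg' j = reg j := by
  have h1 := hn.pos₁
  have h2 := hn.pos₂
  have h3 : x / word w L 2 * w % 2 ^ w = x / word w L 2 * w := Nat.mod_eq_of_lt (by omega)
  have h4 := Nat.mod_eq_of_lt h1
  have h5 := Nat.mod_eq_of_lt h2
  have h6 : x / word w L 2 % 2 ^ w = x / word w L 2 :=
    Nat.mod_eq_of_lt ((Nat.div_le_self _ _).trans_lt hx)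
  refine ⟨_, fun t => by
    rw [show t + 6 = t + 1 + 1 + 1 + 1 + 1 + 1 from rfl, run_op rfl, run_op rfl, run_op rfl,
      run_read rfl, run_op rfl, run_read rfl], hl.congr ?_, ?_, ?_, ?_⟩
  · intro j hj
    fin_cases hj <;> simp
  · simp [Op.eval, r9, hl.r12, hl.r3, hl.r14, h3, h4, h6]
  · simp [Op.eval, r9, hl.r12, hl.r3, hl.r15, h3, h5, h6]
  · intro j hj
    fin_cases hj <;> simp

theorem exists_leads_block {x d : ℕ} (hl : Loaded w L L' reg) (r9 : reg 9 = x)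
    (hx : x < 2 ^ w) (hn : NoOverflow w L x d) :
    ∃ reg', Leads w L L' 6 ⟨40, reg, fun _ => 0⟩ ⟨46, reg', fun _ => 0⟩ ∧ Loaded w L L' reg' ∧
      reg' 26 = readBits L (word w L 6 + x / word w L 3 * word w L 8) (word w L 8) ∧
      reg' 27 = readBits L (word w L 7 + x / word w L 3 * word w L 8) (word w L 8) ∧
      ∀ j ∈ [4, 7, 8, 9, 22, 24, 25], reg' j = reg j := by
  have h1 := hn.pos₃
  have h2 := hn.pos₄
  have h3 : x / word w L 3 * word w L 8 % 2 ^ w = x / word w L 3 * word w L 8 :=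
    Nat.mod_eq_of_lt (by omega)
  have h4 := Nat.mod_eq_of_lt h1
  have h5 := Nat.mod_eq_of_lt h2
  have h6 : x / word w L 3 % 2 ^ w = x / word w L 3 :=
    Nat.mod_eq_of_lt ((Nat.div_le_self _ _).trans_lt hx)
  have h7 := min_eq_left hn.width_le
  refine ⟨_, fun t => by
    rw [show t + 6 = t + 1 + 1 + 1 + 1 + 1 + 1 from rfl, run_op rfl, run_op rfl, run_op rfl,
      run_read rfl, run_op rfl, run_read rfl], hl.congr ?_, ?_, ?_, ?_⟩
  · intro j hj
    fin_cases hj <;> simp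
  · simp [Op.eval, r9, hl.r13, hl.r18, hl.r16, h3, h4, h6, h7]
  · simp [Op.eval, r9, hl.r13, hl.r18, hl.r17, h3, h5, h6, h7]
  · intro j hj
    fin_cases hj <;> simp

theorem exists_leads_table {x d : ℕ} (hl : Loaded w L L' reg) (r9 : reg 9 = x)
    (r24 : reg 24 = readBits L (word w L 4 + x / word w L 2 * w) w)
    (r26 : reg 26 = readBits L (word w L 6 + x / word w L 3 * word w L 8) (word w L 8))
    (hx : x < 2 ^ w) (hn : NoOverflow w L x d) :
    ∃ reg', Leads w L L' 8 ⟨46, reg, fun _ => 0⟩ ⟨54, reg', fun _ => 0⟩ ∧ Loaded w L L' reg' ∧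
      reg' 24 = mark w L x ∧ ∀ j ∈ [4, 7, 8, 9, 22, 25, 27], reg' j = reg j := by
  have h1 : (reg 24 + reg 26) % 2 ^ w = codePos w L x := by
    have := Nat.mod_eq_of_lt hn.pos₅
    rw [codePos, hn.word_zero] at this ⊢
    rw [r24, r26, this]
  have h2 := hn.index
  rw [tableIndex] at h2
  have h3 : readBits L (codePos w L x) (word w L 9) * word w L 3 % 2 ^ w =
    readBits L (codePos w L x) (word w L 9) * word w L 3 := Nat.mod_eq_of_lt (by omega)
  have h4 : x % word w L 3 % 2 ^ w = x % word w L 3 :=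
    Nat.mod_eq_of_lt ((Nat.mod_le _ _).trans_lt hx)
  have h6 := hn.pos₆
  have h8 : (tableIndex w L x * word w L 8 + word w L 10) % 2 ^ w =
      word w L 10 + tableIndex w L x * word w L 8 := by
    rw [add_comm, Nat.mod_eq_of_lt h6]
  have h9 := min_eq_left hn.width_le
  have h10 := min_eq_left hn.code_le
  refine ⟨_, fun t => by
    rw [show t + 8 = t + 1 + 1 + 1 + 1 + 1 + 1 + 1 + 1 from rfl, run_op rfl, run_read rfl,
      run_op rfl, run_op rfl, run_op rfl, run_op rfl, run_op rfl, run_read rfl],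
      hl.congr ?_, ?_, ?_⟩
  · intro j hj
    fin_cases hj <;> simp
  · simp [Op.eval, r9, hl.r13, hl.r18, hl.r19, hl.r20, h1, h3, h4, h9, h10]
    rw [← tableIndex, h8, mark]
  · intro j hj
    fin_cases hj <;> simp

/-- The state of the decoder before it treats the `k`-th candidate. -/
structure LoopState (w : ℕ) (L L' : List Bool) (k : ℕ) (reg : ℕ → ℕ) : Prop where
  loaded : Loaded w L L' reg
  r4 : reg 4 = (12 + 2 * k) * w
  r7 : reg 7 = k
  r8 : reg 8 = best w L L' k

theorem best_lt (w : ℕ) (L L' : List Bool) (k : ℕ) : best w L L' k < 2 ^ w := by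
  induction k with
  | zero => exact Nat.sub_lt (by positivity) one_pos
  | succ k ih =>
    rw [best]
    split_ifs
    · exact ih
    · exact (min_le_left _ _).trans_lt ih

/-- The bound is `6 + 6 + 6 + 8` steps up to the mark, 5 for the sum and 3 for updating the minimum.
-/
theorem exists_leads_loop {k : ℕ} (hs : LoopState w L L' k reg) (hk : k < word w L' 1)
    (hw : (12 + 2 * k + 2) * w < 2 ^ w)
    (hn : NoOverflow w L (candName w L' k) (candDist w L' k)) :
    ∃ reg' l, l ≤ 34 ∧ Leads w L L' l ⟨26, reg, fun _ => 0⟩ ⟨26, reg', fun _ => 0⟩ ∧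
      LoopState w L L' (k + 1) reg' := by
  have hx : candName w L' k < 2 ^ w := word_lt _ _ _
  obtain ⟨reg₁, l₁, hl₁, a4, a7, a8, a9, a22⟩ := exists_leads_candidate hs.loaded hs.r4 hs.r7 hk hw
  obtain ⟨reg₂, l₂, hl₂, b24, b25, hb⟩ := exists_leads_superblock hl₁ a9 hx hn
  obtain ⟨reg₃, l₃, hl₃, c26, c27, hc⟩ := exists_leads_block hl₂
    ((hb 9 (by decide)).trans a9) hx hn
  obtain ⟨reg₄, l₄, hl₄, d24, hd⟩ := exists_leads_table hl₃
    ((hc 9 (by decide)).trans ((hb 9 (by decide)).trans a9))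
    ((hc 24 (by decide)).trans b24) c26 hx hn
  have l := ((l₁.trans l₂).trans l₃).trans l₄
  have r4 : reg₄ 4 = (12 + 2 * (k + 1)) * w := by
    rw [hd 4 (by decide), hc 4 (by decide), hb 4 (by decide), a4]
  have r7 : reg₄ 7 = k + 1 := by
    rw [hd 7 (by decide), hc 7 (by decide), hb 7 (by decide), a7]
  have r8 : reg₄ 8 = best w L L' k := by
    rw [hd 8 (by decide), hc 8 (by decide), hb 8 (by decide), a8, hs.r8]
  have r22 : reg₄ 22 = candDist w L' k := by
    rw [hd 22 (by decide), hc 22 (by decide), hb 22 (by decide), a22]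
  have r25 := (hd 25 (by decide)).trans ((hc 25 (by decide)).trans b25)
  have r27 := (hd 27 (by decide)).trans c27
  by_cases hm : mark w L (candName w L' k) = 0
  · refine ⟨reg₄, _, ?_, l.trans (l := 1) fun t => run_jumpLt_of_lt (i := 24) (j := 1) rfl ?_,
      hl₄, r4, r7, ?_⟩
    · norm_num
    · rw [d24, hm, hl₄.r1]
      exact one_pos
    · rw [r8, best, if_pos hm]
  · obtain ⟨reg₅, l₅, hl₅, e24, he⟩ : ∃ reg', Leads w L L' 5 ⟨54, reg₄, fun _ => 0⟩
        ⟨59, reg', fun _ => 0⟩ ∧ Loaded w L L' reg' ∧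
        reg' 24 = shiftedDist w L (candName w L' k) + candDist w L' k - word w L 11 ∧
        ∀ j ∈ [4, 7, 8], reg' j = reg₄ j := by
      have h1 := hn.total
      have h2 := hn.offset hm
      have h3 := word_lt w L 11
      have hsd : mark w L (candName w L' k) + reg₄ 25 + reg₄ 27 =
          shiftedDist w L (candName w L' k) := by
        rw [r25, r27, shiftedDist, hn.word_zero]
      have h4 : (mark w L (candName w L' k) + reg₄ 25) % 2 ^ w =
        mark w L (candName w L' k) + reg₄ 25 := Nat.mod_eq_of_lt (by omega)
      have h5 : shiftedDist w L (candName w L' k) % 2 ^ w = shiftedDist w L (candName w L' k) :=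
        Nat.mod_eq_of_lt (by omega)
      have h6 := Nat.mod_eq_of_lt h1
      have h7 : (shiftedDist w L (candName w L' k) + candDist w L' k + (2 ^ w - word w L 11)) %
          2 ^ w = shiftedDist w L (candName w L' k) + candDist w L' k - word w L 11 := by
        rw [show shiftedDist w L (candName w L' k) + candDist w L' k + (2 ^ w - word w L 11) =
          shiftedDist w L (candName w L' k) + candDist w L' k - word w L 11 + 2 ^ w by omega,
          Nat.add_mod_right, Nat.mod_eq_of_lt (by omega)]
      refine ⟨_, fun t => by
        rw [show t + 5 = t + 1 + 1 + 1 + 1 + 1 from rfl,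
          run_jumpLt_of_le rfl (by rw [d24, hl₄.r1]; omega),
          run_op rfl, run_op rfl, run_op rfl, run_op rfl], hl₄.congr ?_, ?_, ?_⟩
      · intro j hj
        fin_cases hj <;> simp
      · simp only [Op.eval, Function.update_self, Function.update_of_ne, ne_eq, Nat.reduceEqDiff,
          not_false_eq_true, d24, h4, hsd, h5, r22, h6, hl₄.r21, h7]
      · intro j hj
        fin_cases hj <;> simp
    have l' := l.trans l₅
    have e8 := (he 8 (by decide)).trans r8
    have e4 := (he 4 (by decide)).trans r4
    have e7 := (he 7 (by decide)).trans r7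
    by_cases hlt : best w L L' k < reg₅ 24
    · refine ⟨reg₅, _, ?_, l'.trans (l := 1) fun t => run_jumpLt_of_lt (i := 8) (j := 24) rfl ?_,
        hl₅, e4, e7, ?_⟩
      · norm_num
      · rwa [e8]
      · rw [e8, best, if_neg hm, ← e24, min_eq_left hlt.le]
    · have hmod : reg₅ 24 % 2 ^ w = reg₅ 24 :=
        Nat.mod_eq_of_lt ((not_lt.1 hlt).trans_lt (best_lt w L L' k))
      refine ⟨Function.update reg₅ 8 (reg₅ 24), _, ?_, l'.trans (l := 3) fun t => ?_,
        hl₅.congr ?_, by simpa using e4, by simpa using e7, ?_⟩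
      · norm_num
      · rw [show t + 3 = t + 1 + 1 + 1 from rfl,
          run_jumpLt_of_le (i := 8) (j := 24) (l := 26) rfl (by rw [e8]; exact not_lt.1 hlt),
          run_op rfl, run_jumpLt_of_lt (i := 0) (j := 1) (l := 26) rfl (by simp [hl₅.r0, hl₅.r1])]
        simp [Op.eval, hl₅.r0, hmod]
      · intro j hj
        fin_cases hj <;> simp
      · rw [Function.update_self, best, if_neg hm, ← e24, min_eq_right (not_lt.1 hlt)]

/-- The decoder outputs the smallest sum that it finds, plus one, or zero if it finds none. -/
theorem decoder_outputsWithin (hw : 1 ≤ w) (h0 : word w L 0 = w)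
    (hlen : (12 + 2 * word w L' 1) * w < 2 ^ w)
    (hn : ∀ k < word w L' 1, NoOverflow w L (candName w L' k) (candDist w L' k)) :
    ∃ t ≤ 34 * word w L' 1 + 30,
      OutputsWithin w decoder L L' t ((best w L L' (word w L' 1) + 1) % 2 ^ w) := by
  have hloop : ∀ k ≤ word w L' 1, ∃ reg l, l ≤ 34 * k + 26 ∧
      Leads w L L' l State.init ⟨26, reg, fun _ => 0⟩ ∧ LoopState w L L' k reg := by
    intro k
    induction k with
    | zero =>
      intro _
      obtain ⟨reg, h1, h2, h3, h4, h5⟩ := exists_leads_prologue (L := L) (L' := L') hw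
        (lt_of_le_of_lt (Nat.mul_le_mul_right _ (by omega)) hlen) h0
      exact ⟨reg, 26, le_rfl, h1, h2, h3, h4, h5⟩
    | succ k ih =>
      intro hk
      obtain ⟨reg, l, h1, h2, h3⟩ := ih (by omega)
      obtain ⟨reg', l', h4, h5, h6⟩ := exists_leads_loop h3 hk
        (lt_of_le_of_lt (Nat.mul_le_mul_right _ (by omega)) hlen) (hn k hk)
      exact ⟨reg', _, by omega, h2.trans h5, h6⟩
  obtain ⟨reg, l, h1, h2, h3⟩ := hloop _ le_rfl
  refine ⟨1 + 1 + 1 + l, by omega, ?_⟩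
  rw [OutputsWithin, h2, run_jumpLt_of_le (i := 7) (j := 5) (l := 29) rfl (by
    rw [h3.r7, h3.loaded.r5]), run_op rfl, run_halt rfl]
  simp [Op.eval, h3.r8, h3.loaded.r1]

end

/-! ### The decoder applied to genuine labels. -/

namespace LabelData

theorem candidate_label {D : LabelData} (hD : D.Fits) {k : ℕ} (hk : k < D.cand.length) :
    candName D.w D.label k = D.cand[k].1 ∧ candDist D.w D.label k = D.cand[k].2 := by
  have hget : D.cand[k]? = some D.cand[k] := List.getElem?_eq_getElem hk
  have hdiv : (2 * k + 1) / 2 = k := by omega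
  have hmod : (2 * k + 1) % 2 = 1 := by omega
  constructor
  · rw [candName, word_label_candidate hD (by omega), candidateWord]
    simp [hget]
  · rw [candDist, add_assoc, word_label_candidate hD (by omega), candidateWord]
    simp [hget, hdiv, hmod]

/-- The minimum is characterised by bounds from both sides. The condition `m < 2 ^ w` in the first
one excludes the initial value, which comes from no candidate. -/
theorem best_label {D D' : LabelData} (hD : D.Fits) (hD' : D'.Fits) (hw : D'.w = D.w)
    (hn : D'.n = D.n) {k : ℕ} (hk : k ≤ D'.cand.length) :
    (∀ m, best D.w D.label D'.label k < m → m < 2 ^ D.w →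
      ∃ a ∈ D'.cand, a.1 ∈ D.H ∧ D.e a.1 + a.2 < m) ∧
    ∀ j < k, ∀ a, D'.cand[j]? = some a → a.1 ∈ D.H → best D.w D.label D'.label k ≤ D.e a.1 + a.2 := by
  induction k with
  | zero =>
    refine ⟨fun m h1 h2 => ?_, by omega⟩
    rw [best] at h1
    omega
  | succ k ih =>
    obtain ⟨ih1, ih2⟩ := ih (by omega)
    have hget : D'.cand[k]? = some D'.cand[k] := List.getElem?_eq_getElem (by omega)
    obtain ⟨hname, hdist⟩ := candidate_label hD' (show k < D'.cand.length by omega)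
    rw [hw] at hname hdist
    obtain ⟨hlt, -⟩ := hD'.cand_le _ (List.getElem_mem (show k < D'.cand.length by omega))
    rw [hn] at hlt
    rw [best, hname, hdist]
    simp only [mark_label_eq_zero_iff hD hlt]
    by_cases hH : D'.cand[k].1 ∈ D.H
    · rw [if_neg (not_not.2 hH), shiftedDist_label_of_mem hD hlt hH,
        show D.e D'.cand[k].1 + word D.w D.label 11 + D'.cand[k].2 - word D.w D.label 11 =
          D.e D'.cand[k].1 + D'.cand[k].2 by omega]
      refine ⟨fun m h1 h2 => ?_, fun j hj a ha haH => ?_⟩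
      · rcases min_lt_iff.1 h1 with h | h
        · exact ih1 m h h2
        · exact ⟨_, List.getElem_mem (by omega), hH, h⟩
      · rcases Nat.lt_succ_iff_lt_or_eq.1 hj with h | rfl
        · exact (min_le_left _ _).trans (ih2 j h a ha haH)
        · rw [hget, Option.some_inj] at ha
          subst ha
          exact min_le_right _ _
    · rw [if_pos hH]
      refine ⟨ih1, fun j hj a ha haH => ?_⟩
      rcases Nat.lt_succ_iff_lt_or_eq.1 hj with h | rfl
      · exact ih2 j h a ha haH
      · rw [hget, Option.some_inj] at ha
        subst ha
        exact absurd haH hH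

/-- The decoder computes a distance `δ` from two labels if the candidates of the second label that
are hubs of the first one give no smaller value, and one of them gives `δ` if it is finite. -/
theorem decoder_label {D D' : LabelData} (hD : D.Fits) (hD' : D'.Fits) (hw : D'.w = D.w)
    (hn : D'.n = D.n) (hn1 : 1 ≤ D.n) {δ : ℕ∞}
    (hle : ∀ a ∈ D'.cand, a.1 ∈ D.H → δ ≤ ((D.e a.1 + a.2 : ℕ) : ℕ∞))
    (heq : δ ≠ ⊤ → ∃ a ∈ D'.cand, a.1 ∈ D.H ∧ δ = ((D.e a.1 + a.2 : ℕ) : ℕ∞)) :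
    ∃ t ≤ 34 * D'.cand.length + 30,
      OutputsWithin D.w decoder D.label D'.label t (distCode δ) := by
  have h1 : word D.w D'.label 1 = D'.cand.length := by
    rw [← hw, word_label hD' (by norm_num)]
    rfl
  have htot := hD'.total
  rw [hw] at htot
  have hlen : (12 + 2 * D'.cand.length) * D.w < 2 ^ D.w := by
    have h2 : D'.start 1 = D'.start 0 + _ := D'.start_succ 0
    have h3 : D'.start 2 = D'.start 1 + _ := D'.start_succ 1
    have h4 := D'.start_mono (show 2 ≤ 9 by norm_num)
    simp only [sectionLength] at h2 h3
    rw [← hw, add_mul, hw]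
    rw [hw] at h2 h3
    omega
  have hw1 : 1 ≤ D.w := by
    have := hD.code_le
    have := hD.s_pos
    omega
  obtain ⟨t, ht, hout⟩ := decoder_outputsWithin (w := D.w) (L := D.label) (L' := D'.label) hw1
    (word_label hD (by norm_num)) (by rwa [h1]) (by
      rw [h1]
      intro k hk
      obtain ⟨hname, hdist⟩ := candidate_label hD' hk
      rw [hw] at hname hdist
      obtain ⟨hlt, hle⟩ := hD'.cand_le _ (List.getElem_mem hk)
      rw [hn] at hlt hle
      rw [hname, hdist]
      exact noOverflow_label hD hlt hle)
  rw [h1] at ht hout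
  refine ⟨t, ht, ?_⟩
  convert hout using 1
  obtain ⟨hb1, hb2⟩ := best_label hD hD' hw hn le_rfl
  have hb3 := best_lt D.w D.label D'.label D'.cand.length
  have hpow : 0 < 2 ^ D.w := by positivity
  have hsmall : ∀ a ∈ D'.cand, a.1 ∈ D.H → D.e a.1 + a.2 + 1 < 2 ^ D.w := by
    intro a ha _
    have h2 := hD'.cand_le a ha
    have h3 := hD.e_le a.1 (by omega)
    have h4 := hD.total
    have h5 : 1 ≤ D.s * D.q := Nat.mul_pos hD.s_pos hD.q_pos
    omega
  induction δ using ENat.recTopCoe with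
  | top =>
    have : best D.w D.label D'.label D'.cand.length = 2 ^ D.w - 1 := by
      by_contra hne
      -- A value below the initial one would come from a hub and bound `δ = ⊤` by a finite number.
      obtain ⟨a, ha, haH, -⟩ := hb1 (2 ^ D.w - 1) (by omega) (by omega)
      have := hle a ha haH
      rw [top_le_iff] at this
      exact ENat.natCast_ne_top _ this
    rw [this, Nat.sub_add_cancel hpow, Nat.mod_self]
    rfl
  | coe d =>
    obtain ⟨a, ha, haH, hd⟩ := heq (ENat.natCast_ne_top _)
    obtain ⟨j, hj⟩ := List.mem_iff_getElem?.1 ha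
    have hjl : j < D'.cand.length := (List.getElem?_eq_some_iff.1 hj).1
    have hd' : d = D.e a.1 + a.2 := by exact_mod_cast hd
    have h2 := hb2 j hjl a hj haH
    have h3 := hsmall a ha haH
    have : best D.w D.label D'.label D'.cand.length = d := by
      refine le_antisymm (hd' ▸ h2) (not_lt.1 fun hlt => ?_)
      obtain ⟨a', ha', haH', hlt'⟩ := hb1 d hlt (by omega)
      have := hle a' ha' haH'
      rw [Nat.cast_le] at this
      omega
    rw [this, Nat.mod_eq_of_lt (by omega)]
    rfl

end LabelData

end DistLabel

/-! ### The choice of parameters and the length of a label. -/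

namespace DistLabel

open WordRAM

/-- The number of binary digits of `n`. -/
abbrev digitCount (n : ℕ) : ℕ := Nat.log 2 n + 1

theorem le_four_mul_two_pow (N : ℕ) : N ≤ 4 * 2 ^ (N / 4) := by
  have : N / 4 < 2 ^ (N / 4) := Nat.lt_two_pow_self
  omega

theorem two_pow_digitCount_le {n : ℕ} (hn : n ≠ 0) : 2 ^ digitCount n ≤ 2 * n := by
  rw [pow_succ, mul_comm]
  exact Nat.mul_le_mul_left 2 (Nat.pow_log_le_self 2 hn)

theorem lt_two_pow_digitCount (n : ℕ) : n < 2 ^ digitCount n :=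
  Nat.lt_pow_succ_log_self one_lt_two n

/-- The fourth power is needed in `exists_radius`, where an inequality with the square of
`digitCount n` is squared once more. -/
theorem digitCount_pow_four_le {n : ℕ} (hn : n ≠ 0) : digitCount n ^ 4 ≤ 512 * n := by
  calc digitCount n ^ 4 ≤ (4 * 2 ^ (digitCount n / 4)) ^ 4 :=
        Nat.pow_le_pow_left (le_four_mul_two_pow _) 4
    _ = 256 * 2 ^ (digitCount n / 4 * 4) := by rw [mul_pow, ← pow_mul]; norm_num
    _ ≤ 256 * 2 ^ digitCount n := by
        gcongr
        · norm_num
        · omega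
    _ ≤ 512 * n := by have := two_pow_digitCount_le hn; omega

theorem digitCount_sq_le {n : ℕ} (hn : n ≠ 0) : digitCount n ^ 2 ≤ 512 * n :=
  (Nat.pow_le_pow_right (Nat.succ_pos _) (by norm_num)).trans (digitCount_pow_four_le hn)

namespace LabelData

/-- The amortised bound summed over blocks, whose position intervals are disjoint; `r * m` pays for
the terminators of the codes. -/
theorem mul_pointer_le {D : LabelData} (he : SlowlyVarying D.e) {r : ℕ} (hr : 1 ≤ r) (m : ℕ) :
    r * D.pointer m ≤ r * m + r * D.H.card * (9 + 4 * r.size) + 4 * (m * D.s) := by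
  have key : r * D.pointer m ≤
      r * m + r * (D.H ∩ Finset.range (m * D.s)).card * (9 + 4 * r.size) + 4 * (m * D.s) := by
    induction m with
    | zero => simp [pointer]
    | succ m ih =>
      have h1 := mul_length_encPairs_gaps_le (H := D.H) he hr D.s (le_refl (m * D.s))
      have h2 : (D.H ∩ Finset.range ((m + 1) * D.s)).card =
          (D.H ∩ Finset.range (m * D.s)).card +
            (D.H ∩ Finset.Ico (m * D.s) (m * D.s + D.s)).card := by
        rw [← Finset.card_union_of_disjoint, ← Finset.inter_union_distrib_left]
        · congr 2
          ext i
          simp only [Finset.mem_range, Finset.mem_union, Finset.mem_Ico, add_mul, one_mul]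
          omega
        · rw [Finset.disjoint_left]
          intro i hi hi'
          simp only [Finset.mem_inter, Finset.mem_range, Finset.mem_Ico] at hi hi'
          omega
      rw [pointer, Finset.sum_range_succ, ← pointer, blockCode, h2]
      rw [Nat.sub_self, add_zero] at h1
      nlinarith
  have h3 : (D.H ∩ Finset.range (m * D.s)).card ≤ D.H.card :=
    Finset.card_le_card Finset.inter_subset_left
  have h4 : r * (D.H ∩ Finset.range (m * D.s)).card * (9 + 4 * r.size) ≤
      r * D.H.card * (9 + 4 * r.size) := by gcongr
  omega

/-- The standard choice of the parameters for a graph with `n` vertices. -/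
def standard (n : ℕ) (H : Finset ℕ) (e : ℕ → ℕ) (cand : List (ℕ × ℕ)) : LabelData where
  n := n
  -- Then `16 * s ≤ digitCount n / 4 + 16`, so there are only `O(n ^ (1/4))` table rows, while the
  -- number of blocks is `O(n / log n)`.
  s := digitCount n / 64 + 1
  q := digitCount n
  -- Since `2 ^ f > 256 * (digitCount n) ^ 2`, this exceeds `16 * (s * q)`; it is still `O(log log
  -- n)`.
  f := 2 * (digitCount n).size + 8
  w := 64 * digitCount n
  H := H
  e := e
  cand := cand

variable {n : ℕ} {H : Finset ℕ} {e : ℕ → ℕ} {cand : List (ℕ × ℕ)}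

theorem start_nine (D : LabelData) : D.start 9 = 13 * D.w + 1 + 2 * D.cand.length * D.w +
    2 * (D.superblocks * D.w) + 2 * (D.blocks * D.f) + D.pointer D.blocks +
    2 ^ (16 * D.s) * D.s * D.f := by
  simp only [start, Finset.sum_range_succ, Finset.sum_range_zero, sectionLength]
  ring

theorem two_pow_code_le (n : ℕ) :
    2 ^ (16 * (digitCount n / 64 + 1)) ≤ 2 ^ 16 * 2 ^ (digitCount n / 4) := by
  rw [← pow_add]
  exact Nat.pow_le_pow_right two_pos (by omega)

theorem standard_fits (hn : 2 ≤ n) (he : SlowlyVarying e) (hle : ∀ i ≤ n, e i ≤ 3 * n)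
    (hcand : ∀ a ∈ cand, a.1 < n ∧ a.2 ≤ n) (hlen : cand.length ≤ n) :
    (standard n H e cand).Fits := by
  have hN : 2 ≤ digitCount n := by
    have : 1 ≤ Nat.log 2 n := Nat.log_pos one_lt_two hn
    simp only [digitCount]
    omega
  have hsize := size_le_self (digitCount n)
  have hsq : (digitCount n / 64 + 1) * digitCount n ≤ digitCount n * digitCount n :=
    Nat.mul_le_mul_right _ (by omega)
  refine ⟨?_, ?_, he, hle, hcand, ?_, ?_, ?_, ?_⟩
  · simp [standard]
  · simp [standard]
  · simp only [standard]
    have h1 : digitCount n < 2 ^ (digitCount n).size := Nat.lt_size_self _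
    have h2 : digitCount n * digitCount n < 2 ^ (digitCount n).size * 2 ^ (digitCount n).size :=
      Nat.mul_lt_mul'' h1 h1
    rw [pow_add, two_mul, pow_add]
    omega
  · simp only [standard]
    omega
  · simp only [standard]
    omega
  · rw [start_nine]
    have hsp : (standard n H e cand).pointer (standard n H e cand).blocks ≤
        (standard n H e cand).blocks * (1 + 13 * (standard n H e cand).s) := by
      rw [pointer]
      have : ∀ b ∈ Finset.range (standard n H e cand).blocks,
          ((standard n H e cand).blockCode b).length ≤ 1 + 13 * (standard n H e cand).s := by
        intro b _
        rw [blockCode]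
        simpa using length_encPairs_gaps_le (H := (standard n H e cand).H)
          (e := (standard n H e cand).e) he (standard n H e cand).s
          (le_refl (b * (standard n H e cand).s))
      simpa using Finset.sum_le_card_nsmul _ _ _ this
    have hb : (standard n H e cand).blocks ≤ n + 1 :=
      Nat.succ_le_succ (Nat.div_le_self _ _)
    have hsb : (standard n H e cand).superblocks ≤ n + 1 :=
      Nat.succ_le_succ (Nat.div_le_self _ _)
    generalize (standard n H e cand).blocks = nb at *
    generalize (standard n H e cand).superblocks = nsb at *
    generalize (standard n H e cand).pointer nb = ptr at *
    simp only [standard] at *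
    have h2 := two_pow_code_le n
    have hnZ := lt_two_pow_digitCount n
    have hNZ : digitCount n < 2 ^ digitCount n := Nat.lt_two_pow_self
    have h3 : 2 ^ (digitCount n / 4) ≤ 2 ^ digitCount n :=
      Nat.pow_le_pow_right two_pos (Nat.div_le_self _ _)
    have h4 : 2 ^ 2 ≤ 2 ^ digitCount n := Nat.pow_le_pow_right two_pos hN
    have hs : digitCount n / 64 + 1 ≤ 2 ^ digitCount n := by omega
    have hf : 2 * (digitCount n).size + 8 ≤ 10 * 2 ^ digitCount n := by omega
    have hpow : 2 ^ (64 * digitCount n) = (2 ^ digitCount n) ^ 64 := by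
      rw [← pow_mul, mul_comm]
    rw [hpow]
    -- With `n < Z`, every section has length `O(Z ^ 3)`, far below `2 ^ w = Z ^ 64`.
    generalize 2 ^ digitCount n = Z at *
    generalize 2 ^ (16 * (digitCount n / 64 + 1)) = Q at *
    generalize digitCount n / 64 + 1 = s at *
    generalize 2 * (digitCount n).size + 8 = f at *
    generalize digitCount n = N at *
    have hQ : Q ≤ 2 ^ 16 * Z := by omega
    have t1 : 2 * cand.length * (64 * N) ≤ 2 * Z * (64 * Z) := by gcongr; omega
    have t2 : nsb * (64 * N) ≤ Z * (64 * Z) := by gcongr; omega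
    have t3 : nb * f ≤ Z * (10 * Z) := by gcongr; omega
    have t4 : ptr ≤ Z * (14 * Z) := hsp.trans (by gcongr <;> omega)
    have t5 : Q * s * f ≤ 2 ^ 16 * Z * Z * (10 * Z) := by gcongr
    have t6 : s * N ≤ Z * Z := by gcongr
    have hZ2 : Z ≤ Z * Z := Nat.le_mul_of_pos_left _ (by omega)
    have hZ3 : Z * Z ≤ Z * Z * Z := Nat.le_mul_of_pos_right _ (by omega)
    have t7 : 2 ^ 20 * (Z * Z * Z) ≤ Z ^ 64 := by
      calc 2 ^ 20 * (Z * Z * Z) = (2 ^ 2) ^ 10 * (Z * Z * Z) := by norm_num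
        _ ≤ Z ^ 10 * (Z * Z * Z) := by gcongr
        _ = Z ^ 13 := by ring
        _ ≤ Z ^ 64 := Nat.pow_le_pow_right (by omega) (by norm_num)
    have t8 : 2 ^ 16 * Z * Z * (10 * Z) = 655360 * (Z * Z * Z) := by ring
    have t9 : 0 < Z * Z * Z := by positivity
    have u1 : 2 * Z * (64 * Z) = 128 * (Z * Z) := by ring
    have u2 : Z * (64 * Z) = 64 * (Z * Z) := by ring
    have u3 : Z * (10 * Z) = 10 * (Z * Z) := by ring
    have u4 : Z * (14 * Z) = 14 * (Z * Z) := by ring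
    omega

/-- The length of a label, up to a constant factor, if there are `O(n / r)` hubs and few
candidates. -/
theorem length_standard_le (hn : 2 ≤ n) (he : SlowlyVarying e) {r : ℕ} (hr : 1 ≤ r)
    (hH : r * H.card ≤ 2000 * n) (hcand : cand.length * digitCount n ^ 2 ≤ 2000 * n) :
    r * digitCount n * (standard n H e cand).label.length ≤
      10 ^ 10 * (n * (r * (digitCount n).size + digitCount n * r.size)) := by
  rw [length_label, start_nine]
  have hp := mul_pointer_le (D := standard n H e cand) he hr (standard n H e cand).blocks
  have hb : (standard n H e cand).blocks = n / (digitCount n / 64 + 1) + 1 := rfl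
  have hsb : (standard n H e cand).superblocks =
    n / ((digitCount n / 64 + 1) * digitCount n) + 1 := rfl
  generalize (standard n H e cand).blocks = nb at *
  generalize (standard n H e cand).superblocks = nsb at *
  generalize (standard n H e cand).pointer nb = ptr at *
  simp only [standard] at *
  have h2 := two_pow_code_le n
  have hN := le_four_mul_two_pow (digitCount n)
  have hsq := digitCount_sq_le (n := n) (by omega)
  have hZ := two_pow_digitCount_le (n := n) (by omega)
  have hY : (2 ^ (digitCount n / 4)) ^ 4 ≤ 2 ^ digitCount n := by
    rw [← pow_mul]
    exact Nat.pow_le_pow_right two_pos (by omega)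
  have hsz : 1 ≤ (digitCount n).size := Nat.size_pos.2 (Nat.succ_pos _)
  have hszN := size_le_self (digitCount n)
  have hrs : 1 ≤ r.size := Nat.size_pos.2 hr
  have hN1 : 1 ≤ digitCount n := Nat.succ_pos _
  have hsN : digitCount n ≤ 64 * (digitCount n / 64 + 1) := by omega
  have hs : digitCount n / 64 + 1 ≤ digitCount n := by omega
  have hd1 : (digitCount n / 64 + 1) * (n / (digitCount n / 64 + 1)) ≤ n := Nat.mul_div_le _ _
  have hd2 : (digitCount n / 64 + 1) * digitCount n * (n / ((digitCount n / 64 + 1) * digitCount n))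
    ≤ n := Nat.mul_div_le _ _
  have hYpos : 0 < 2 ^ (digitCount n / 4) := by positivity
  generalize 2 ^ (digitCount n / 4) = Y at *
  generalize 2 ^ digitCount n = Z at *
  generalize 2 ^ (16 * (digitCount n / 64 + 1)) = Q at *
  generalize digitCount n / 64 + 1 = s at *
  generalize (digitCount n).size = σ at *
  generalize digitCount n = N at *
  have b1 : N * nb ≤ 576 * n := by
    rw [hb]
    have : N * (n / s) ≤ 64 * (s * (n / s)) := by rw [← mul_assoc]; gcongr
    have : N ≤ N ^ 2 := Nat.le_self_pow (by norm_num) N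
    rw [mul_add]
    omega
  have b2 : N * N * nsb ≤ 576 * n := by
    rw [hsb]
    have : N * N * (n / (s * N)) ≤ 64 * (s * N * (n / (s * N))) := by
      rw [← mul_assoc 64, ← mul_assoc 64]
      gcongr
    have : N * N = N ^ 2 := by ring
    rw [mul_add]
    omega
  have b3 : s * nb ≤ 513 * n := by
    rw [hb, mul_add]
    have : N ≤ N ^ 2 := Nat.le_self_pow (by norm_num) N
    omega
  -- The table: `Q = O(Y)`, and each of `N`, `s` and `2 * σ + 8` is `O(N) = O(Y)`; finally `Y ^ 4 ≤
  -- 2 * n`.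
  have b4 : N * (Q * s * (2 * σ + 8)) ≤ 10 ^ 8 * n := by
    calc N * (Q * s * (2 * σ + 8)) ≤ N * (2 ^ 16 * Y * N * (2 * N + 8 * N)) := by
          gcongr
          exact Nat.le_mul_of_pos_right _ hN1
      _ = 655360 * Y * (N * N * N) := by ring
      _ ≤ 655360 * Y * ((4 * Y) * (4 * Y) * (4 * Y)) := by gcongr
      _ = 41943040 * Y ^ 4 := by ring
      _ ≤ 10 ^ 8 * n := by omega
  have b5 : N * (13 * (64 * N) + 1) ≤ 500000 * n := by
    have e1 : N * (13 * (64 * N) + 1) = 832 * N ^ 2 + N := by ring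
    have : N ≤ N ^ 2 := Nat.le_self_pow (by norm_num) N
    rw [e1]
    omega
  have b6 : N * (2 * cand.length * (64 * N)) ≤ 256000 * n := by
    have e1 : N * (2 * cand.length * (64 * N)) = 128 * (cand.length * N ^ 2) := by ring
    omega
  have b7 : N * (2 * (nsb * (64 * N))) ≤ 100000 * n := by
    have e1 : N * (2 * (nsb * (64 * N))) = 128 * (N * N * nsb) := by ring
    omega
  -- The fields of the blocks, `O(n / N)` of them with `O(σ)` bits each, are the source of the term
  -- `n log log n / log n`.
  have b8 : N * (2 * (nb * (2 * σ + 8))) ≤ 20000 * (n * σ) := by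
    calc N * (2 * (nb * (2 * σ + 8))) ≤ N * (2 * (nb * (2 * σ + 8 * σ))) := by
          gcongr
          omega
      _ = 20 * (N * nb) * σ := by ring
      _ ≤ 20 * (576 * n) * σ := by gcongr
      _ = 11520 * (n * σ) := by ring
      _ ≤ 20000 * (n * σ) := by gcongr; norm_num
  have b9 : r * N * ptr ≤ 576 * (n * r) + N * (30000 * (n * r.size)) := by
    have e1 : r * H.card * (9 + 4 * r.size) ≤ 2000 * n * (9 * r.size + 4 * r.size) := by
      gcongr
      omega
    have e2 : n ≤ n * r.size := Nat.le_mul_of_pos_right _ hrs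
    calc r * N * ptr = N * (r * ptr) := by ring
      _ ≤ N * (r * nb + 2000 * n * (9 * r.size + 4 * r.size) + 4 * (s * nb)) := by
          gcongr
          rw [mul_comm s]
          omega
      _ = N * nb * r + N * (26000 * (n * r.size) + 4 * (s * nb)) := by ring
      _ ≤ 576 * n * r + N * (30000 * (n * r.size)) := by
          gcongr
          omega
      _ = _ := by ring
  have b10 : n ≤ n * σ := Nat.le_mul_of_pos_right _ hsz
  calc _ = r * (N * (13 * (64 * N) + 1) + N * (2 * cand.length * (64 * N)) +
        N * (2 * (nsb * (64 * N))) + N * (2 * (nb * (2 * σ + 8))) + N * (Q * s * (2 * σ + 8))) +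
        r * N * ptr := by ring
    _ ≤ r * (2 * 10 ^ 8 * (n * σ)) + (576 * (n * r) + N * (30000 * (n * r.size))) := by
        gcongr
        omega
    _ ≤ r * (2 * 10 ^ 8 * (n * σ)) + (576 * (n * σ * r) + N * (30000 * (n * r.size))) := by gcongr
    _ ≤ 10 ^ 10 * (n * (r * σ + N * r.size)) := by
        have e1 : 0 ≤ r * n * σ := Nat.zero_le _
        nlinarith [Nat.zero_le (r * n * σ), Nat.zero_le (N * n * r.size)]

end LabelData

end DistLabel

/-! ### Estimates of logarithms and the choice of the radius. -/

namespace DistLabel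

open WordRAM

theorem size_le_logb {m : ℕ} (hm : 1 ≤ m) : (m.size : ℝ) ≤ 2 * Real.logb 2 (1 + m) := by
  have hm' : (1 : ℝ) ≤ m := by exact_mod_cast hm
  have h1 : 2 ^ (m.size - 1) ≤ m := Nat.lt_size.1 (by have := Nat.size_pos.2 hm; omega)
  have h2 : 2 ^ m.size ≤ 2 * m := by
    obtain ⟨k, hk⟩ : ∃ k, m.size = k + 1 := ⟨m.size - 1, by have := Nat.size_pos.2 hm; omega⟩
    rw [hk, Nat.add_sub_cancel] at h1
    rw [hk, pow_succ]
    omega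
  have h3 : (2 : ℝ) ^ (m.size : ℝ) ≤ (1 + m) ^ (2 : ℕ) := by
    rw [Real.rpow_natCast]
    calc (2 : ℝ) ^ m.size ≤ 2 * m := by exact_mod_cast h2
      _ ≤ _ := by nlinarith
  rw [← Real.le_logb_iff_rpow_le one_lt_two (by positivity), Real.logb_pow] at h3
  exact_mod_cast h3

/-- The function `x ↦ log (1 + x) / x` is almost decreasing. -/
theorem mul_logb_le {R m : ℝ} (hR : 1 ≤ R) (hm : 1 ≤ m) (h : R ≤ 4 * m) :
    R * Real.logb 2 (1 + m) ≤ 4 * m * Real.logb 2 (1 + R) := by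
  have h0 : 0 ≤ Real.logb 2 (1 + R) := Real.logb_nonneg one_lt_two (by linarith)
  rcases le_total m R with hmR | hmR
  · have h1 : Real.logb 2 (1 + m) ≤ Real.logb 2 (1 + R) :=
      Real.logb_le_logb_of_le one_lt_two (by linarith) (by linarith)
    calc _ ≤ R * Real.logb 2 (1 + R) := by gcongr
      _ ≤ _ := by gcongr
  · have h1 := one_add_mul_self_le_rpow_one_add (s := R) (by linarith) (p := m / R)
      (by rwa [one_le_div (by linarith)])
    rw [div_mul_cancel₀ _ (by linarith)] at h1
    have h2 : Real.logb 2 (1 + m) ≤ m / R * Real.logb 2 (1 + R) := by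
      rw [← Real.logb_rpow_eq_mul_logb_of_pos (by linarith)]
      exact Real.logb_le_logb_of_le one_lt_two (by linarith) h1
    calc R * Real.logb 2 (1 + m) ≤ R * (m / R * Real.logb 2 (1 + R)) := by gcongr
      _ = m * Real.logb 2 (1 + R) := by field_simp
      _ ≤ _ := by nlinarith

/-- Used for `m = r` and for `m = digitCount n`, which turns both terms of the label length into
`log (1 + R) / R`. -/
theorem size_div_le {R : ℝ} {m : ℕ} (hR : 1 ≤ R) (hm : 1 ≤ m) (h : R ≤ 4 * m) :
    (m.size : ℝ) / m ≤ 8 * (Real.logb 2 (1 + R) / R) := by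
  have hm' : (1 : ℝ) ≤ m := by exact_mod_cast hm
  have h1 := mul_logb_le hR hm' h
  have h2 := size_le_logb hm
  rw [← mul_div_assoc, div_le_div_iff₀ (by linarith) (by linarith)]
  nlinarith

section Radius

variable {n Δ : ℕ} {T : ℝ}

theorem one_le_logb (hΔ : 2 ≤ Δ) (hT : (Δ : ℝ) ≤ T) : 1 ≤ Real.logb Δ T := by
  have : (1 : ℝ) < Δ := by exact_mod_cast hΔ
  rw [Real.le_logb_iff_rpow_le this (by linarith), Real.rpow_one]
  exact hT

theorem pow_le_of_le_logb (hΔ : 2 ≤ Δ) (hT : (Δ : ℝ) ≤ T) {k : ℕ} (hk : (k : ℝ) ≤ Real.logb Δ T) :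
    (Δ : ℝ) ^ k ≤ T := by
  have : (1 : ℝ) < Δ := by exact_mod_cast hΔ
  rwa [Real.le_logb_iff_rpow_le this (by linarith), Real.rpow_natCast] at hk

theorem logb_le_digitCount (hΔ : 2 ≤ Δ) (hT : (Δ : ℝ) ≤ T) (hTn : T ≤ n) :
    Real.logb Δ T ≤ digitCount n := by
  have h2 : (2 : ℝ) ≤ Δ := by exact_mod_cast hΔ
  rw [Real.logb_le_iff_le_rpow (by linarith) (by linarith), Real.rpow_natCast]
  calc T ≤ n := hTn
    _ ≤ (2 : ℝ) ^ digitCount n := by exact_mod_cast (lt_two_pow_digitCount n).le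
    _ ≤ _ := by gcongr

theorem digitCount_le_logb (hn : 2 ≤ n) : (digitCount n : ℝ) ≤ 2 * Real.logb 2 n := by
  have h1 : (1 : ℝ) ≤ Nat.log 2 n := by exact_mod_cast Nat.log_pos one_lt_two hn
  have h2 : (Nat.log 2 n : ℝ) ≤ Real.logb 2 n := by exact_mod_cast Real.natLog_le_logb n 2
  push_cast [digitCount]
  linarith

/-- The radius used for the labels: it is `⌊R⌋` if the balls of this radius are small. -/
theorem exists_radius (hΔ : 2 ≤ Δ) (hT : (Δ : ℝ) ≤ T) (hTn : T ≤ n) :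
    ∃ r : ℕ, 1 ≤ r ∧ (r : ℝ) ≤ Real.logb Δ T ∧ Real.logb Δ T ≤ 4 * (r : ℝ) ∧
      (T * Real.logb 2 n ^ 2 ≤ (n : ℝ) → r = ⌊Real.logb Δ T⌋₊) ∧
      Δ ^ (r - 1) * digitCount n ^ 2 ≤ 512 * n ∧ (r = 1 ∨ r * Δ ^ r ≤ 512 * n) := by
  have hn : 2 ≤ n := by
    have : (2 : ℝ) ≤ n := le_trans (by exact_mod_cast hΔ) (hT.trans hTn)
    exact_mod_cast this
  have hR := one_le_logb hΔ hT
  have hRN := logb_le_digitCount hΔ hT hTn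
  -- The first bound makes the candidate list take `O(n / log n)` bits; the second makes a ball
  -- contribute only `O(n / r)` hubs.
  have hfinish : ∀ r : ℕ, 1 ≤ r → (r : ℝ) ≤ Real.logb Δ T →
      Δ ^ r * digitCount n ^ 2 ≤ 512 * n →
      Δ ^ (r - 1) * digitCount n ^ 2 ≤ 512 * n ∧ (r = 1 ∨ r * Δ ^ r ≤ 512 * n) := by
    intro r h1 h2 h3
    have h4 : r ≤ digitCount n := by exact_mod_cast h2.trans hRN
    have h5 : r ≤ digitCount n ^ 2 := h4.trans (Nat.le_self_pow two_ne_zero _)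
    constructor
    · refine le_trans ?_ h3
      gcongr
      · omega
      · omega
    · right
      refine le_trans ?_ h3
      rw [mul_comm]
      gcongr
  by_cases hcase : T * Real.logb 2 n ^ 2 ≤ (n : ℝ)
  · have h1 : 1 ≤ ⌊Real.logb Δ T⌋₊ := Nat.le_floor (by exact_mod_cast hR)
    have h2 : (⌊Real.logb Δ T⌋₊ : ℝ) ≤ Real.logb Δ T := Nat.floor_le (by linarith)
    have h3 := Nat.lt_floor_add_one (Real.logb Δ T)
    have h1' : (1 : ℝ) ≤ ⌊Real.logb Δ T⌋₊ := by exact_mod_cast h1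
    refine ⟨_, h1, h2, by linarith, fun _ => rfl, hfinish _ h1 h2 ?_⟩
    have h4 := pow_le_of_le_logb hΔ hT h2
    have h5 := digitCount_le_logb hn
    have h6 : (Δ : ℝ) ^ ⌊Real.logb Δ T⌋₊ * (digitCount n : ℝ) ^ 2 ≤ 512 * n := by
      calc _ ≤ T * (2 * Real.logb 2 n) ^ 2 := by gcongr; linarith
        _ = 4 * (T * Real.logb 2 n ^ 2) := by ring
        _ ≤ 512 * n := by
          have : (0 : ℝ) ≤ n := Nat.cast_nonneg n
          linarith
    exact_mod_cast h6
  -- Here `T` is close to `n`. For `R < 2` the radius 1 will do. Otherwise `r = ⌊R / 2⌋` gives `Δ ^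
  -- (2 * r) ≤ T ≤ n`, and the required inequality is proved in squared form.
  · by_cases h2 : Real.logb Δ T < 2
    · refine ⟨1, le_rfl, by exact_mod_cast hR, by push_cast; linarith, fun h => absurd h hcase, ?_,
        Or.inl rfl⟩
      simpa using digitCount_sq_le (n := n) (by omega)
    · rw [not_lt] at h2
      have h3 : 1 ≤ ⌊Real.logb Δ T / 2⌋₊ := Nat.le_floor (by push_cast; linarith)
      have h4 : (⌊Real.logb Δ T / 2⌋₊ : ℝ) ≤ Real.logb Δ T / 2 := Nat.floor_le (by linarith)
      have h5 := Nat.lt_floor_add_one (Real.logb Δ T / 2)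
      have h3' : (1 : ℝ) ≤ ⌊Real.logb Δ T / 2⌋₊ := by exact_mod_cast h3
      refine ⟨_, h3, by linarith, by linarith, fun h => absurd h hcase, hfinish _ h3 (by linarith) ?_⟩
      have h6 := pow_le_of_le_logb hΔ hT (k := ⌊Real.logb Δ T / 2⌋₊ * 2) (by push_cast; linarith)
      have h7 : Δ ^ (⌊Real.logb Δ T / 2⌋₊ * 2) ≤ n := by exact_mod_cast h6.trans hTn
      have h8 := digitCount_pow_four_le (n := n) (by omega)
      refine (Nat.pow_le_pow_iff_left two_ne_zero).1 ?_
      calc (Δ ^ ⌊Real.logb Δ T / 2⌋₊ * digitCount n ^ 2) ^ 2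
          = Δ ^ (⌊Real.logb Δ T / 2⌋₊ * 2) * digitCount n ^ 4 := by rw [pow_mul]; ring
        _ ≤ n * (512 * n) := by gcongr
        _ ≤ (512 * n) ^ 2 := by nlinarith

end Radius

/-! ### Assembling the labels of a graph. -/

section Final

variable {n : ℕ} {G : SimpleGraph (Fin n)} {c : Sym2 (Fin n) → ℕ}

/-- On the component of `u` the distance is 3-Lipschitz in the number. The extension fills the
numbers of unreachable vertices with finite values, so the codes never meet `∞`; it is at most `3 *
n` because the distance is 0 at `u` itself. -/
theorem exists_distance_extension (hc : ∀ e ∈ G.edgeSet, c e = 0 ∨ c e = 1)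
    (name : Equiv.Perm (Fin n))
    (hname : ∀ x y, G.Reachable x y →
      ∃ p : G.Walk x y, p.length ≤ 3 * (((name x : ℕ) - name y) + ((name y : ℕ) - name x)))
    (u : Fin n) :
    ∃ e : ℕ → ℕ, SlowlyVarying e ∧ (∀ x, G.Reachable u x → dist G c u x = e (name x)) ∧
      ∀ i ≤ n, e i ≤ 3 * n := by
  have : Nonempty {x // G.Reachable u x} := ⟨⟨u, .refl u⟩⟩
  have hd : ∀ x, G.Reachable u x → ((dist G c u x).toNat : ℕ∞) = dist G c u x := fun x hx =>
    ENat.natCast_toNat (dist_ne_top_iff.2 hx)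
  obtain ⟨e, he, hex, hle⟩ := exists_lipschitz_extension
    (fun x : {x // G.Reachable u x} => (name x.1 : ℕ)) (fun x => (dist G c u x.1).toNat) (by
      rintro ⟨x, hx⟩ ⟨y, hy⟩
      obtain ⟨p, hp⟩ := hname y x (hy.symm.trans hx)
      have h1 := dist_triangle (G := G) (c := c) u y x
      have h2 : dist G c y x ≤ p.length :=
        (dist_le_walkCost p).trans (by exact_mod_cast walkCost_le_length hc p)
      have h3 := h1.trans (add_le_add_right h2 _)
      rw [← hd x hx, ← hd y hy, ← Nat.cast_add, Nat.cast_le] at h3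
      dsimp only
      omega)
  refine ⟨e, he, fun x hx => ?_, fun i hi => ?_⟩
  · rw [hex ⟨x, hx⟩, hd x hx]
  · have h1 := hle ⟨u, .refl u⟩ i
    have h2 := (name u).isLt
    simp only [dist_self, ENat.toNat_zero] at h1
    omega

end Final

/-- The hub table stored in a label. -/
def hubTableOf (L : List Bool) (x : ℕ) : Option ℕ :=
  lookup (L.reverse.takeWhile id).length L x

end DistLabel

open DistLabel in
theorem theorem1 :
    ∃ (C κ : ℕ) (P : List WordRAM.Instr) (hubTable : List Bool → ℕ → Option ℕ),
      ∀ (n Δ : ℕ) (T : ℝ), 2 ≤ Δ → (Δ : ℝ) ≤ T → T ≤ (n : ℝ) →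
        ∃ r : ℕ,
          1 ≤ r ∧ (r : ℝ) ≤ Real.logb Δ T ∧ Real.logb Δ T ≤ 4 * (r : ℝ) ∧
          (T * Real.logb 2 n ^ 2 ≤ (n : ℝ) → r = ⌊Real.logb Δ T⌋₊) ∧
          ∀ (G : SimpleGraph (Fin n)) [DecidableRel G.Adj] (c : Sym2 (Fin n) → ℕ),
            (∀ v, G.degree v ≤ Δ) → (∀ e ∈ G.edgeSet, c e = 0 ∨ c e = 1) →
            -- hub sets with radius and modulus `⌊R⌋`
            (∃ offset : Fin n → ℕ,
              DistLabel.SparseOffset G c ⌊Real.logb Δ T⌋₊ offset ∧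
              DistLabel.ShortestPathCover G c
                (DistLabel.hubSet G c ⌊Real.logb Δ T⌋₊ offset)) ∧
            -- the labeling, which stores the hub sets with radius and modulus `r`
            ∃ (offset : Fin n → ℕ) (name : Equiv.Perm (Fin n)) (label : Fin n → List Bool),
              DistLabel.SparseOffset G c r offset ∧
              DistLabel.ShortestPathCover G c (DistLabel.hubSet G c r offset) ∧
              (∀ u x d, hubTable (label u) (name x : ℕ) = some d ↔
                x ∈ DistLabel.hubSet G c r offset u ∧ DistLabel.dist G c u x = (d : ℕ∞)) ∧
              (∀ u, ((label u).length : ℝ) ≤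
                C * ((n : ℝ) / Real.logb Δ T * Real.logb 2 (1 + Real.logb Δ T))) ∧
              (∀ u v, ∃ t : ℕ, (t : ℝ) ≤ C * T ∧
                WordRAM.OutputsWithin (κ * (Nat.log 2 n + 1)) P (label u) (label v) t
                  (DistLabel.distCode (DistLabel.dist G c u v))) := by
  classical
  -- `16 = 8 + 8` comes from the two uses of `size_div_le` and `10 ^ 10` from `length_standard_le`;
  -- 64 is the factor in the word size of `standard`.
  refine ⟨16 * 10 ^ 10, 64, WordRAM.decoder, hubTableOf, ?_⟩
  intro n Δ T hΔ hT hTn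
  have hΔ' : (2 : ℝ) ≤ Δ := by exact_mod_cast hΔ
  have hn : 2 ≤ n := by
    have : (2 : ℝ) ≤ n := hΔ'.trans (hT.trans hTn)
    exact_mod_cast this
  have hR := one_le_logb hΔ hT
  have hRN := logb_le_digitCount hΔ hT hTn
  obtain ⟨r, hr, hrR, hRr, hfloor, hsmall, hball⟩ := exists_radius hΔ hT hTn
  refine ⟨r, hr, hrR, hRr, hfloor, ?_⟩
  intro G _ c hdeg hc
  constructor
  · have h1 : 1 ≤ ⌊Real.logb Δ T⌋₊ := Nat.le_floor (by exact_mod_cast hR)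
    obtain ⟨offset, ho⟩ := exists_sparseOffset G c h1
    exact ⟨offset, ho, shortestPathCover_hubSet h1 fun u => (ho u).1⟩
  have hrN : r ≤ digitCount n := by exact_mod_cast hrR.trans hRN
  have hNn : digitCount n ≤ n := Nat.log_lt_self 2 (by omega)
  obtain ⟨offset, ho⟩ := exists_sparseOffset G c hr
  obtain ⟨name, hname⟩ := exists_numbering G
  choose e he hex hle using exists_distance_extension hc name hname
  let H : Fin n → Finset ℕ := fun u =>
    (hubSet G c r offset u).toFinset.image fun x => (name x : ℕ)
  have hmem : ∀ u x, (name x : ℕ) ∈ H u ↔ x ∈ hubSet G c r offset u := by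
    intro u x
    simp only [H, Finset.mem_image, Set.mem_toFinset]
    constructor
    · rintro ⟨y, hy, hyx⟩
      rwa [← name.injective (Fin.ext hyx)]
    · exact fun h => ⟨x, h, rfl⟩
  -- Radius `r - 1` instead of `r` matters for the space: with `r = 1` and `Δ` near `n`, a list of
  -- the ball of radius 1 could take about `n log n` bits.
  let cand : Fin n → List (ℕ × ℕ) := fun u =>
    (ball G (r - 1) u).toFinset.toList.map fun x => ((name x : ℕ), (dist G c u x).toNat)
  have hcmem : ∀ u a, a ∈ cand u ↔
      ∃ x ∈ ball G (r - 1) u, ((name x : ℕ), (dist G c u x).toNat) = a := by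
    intro u a
    simp [cand]
  have hclen : ∀ u, (cand u).length = (ball G (r - 1) u).ncard := by
    intro u
    simp [cand, Set.ncard_eq_toFinset_card']
  have hclen' : ∀ u, (cand u).length ≤ 2 * Δ ^ (r - 1) := by
    intro u
    have := ncard_ball_le hΔ hdeg (r - 1) u
    rw [hclen]
    omega
  have hd : ∀ u x, G.Reachable u x → ((dist G c u x).toNat : ℕ∞) = dist G c u x := fun u x hx =>
    ENat.natCast_toNat (dist_ne_top_iff.2 hx)
  have hfits : ∀ u, (LabelData.standard n (H u) (e u) (cand u)).Fits := by
    intro u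
    refine LabelData.standard_fits hn (he u) (hle u) ?_ ?_
    · intro a ha
      obtain ⟨x, hx, rfl⟩ := (hcmem u a).1 ha
      refine ⟨(name x).isLt, ?_⟩
      obtain ⟨p, hp⟩ := hx
      have h1 : dist G c u x ≤ p.length :=
        (dist_le_walkCost p).trans (by exact_mod_cast walkCost_le_length hc p)
      rw [← hd u x ⟨p⟩, Nat.cast_le] at h1
      dsimp only
      omega
    · rw [hclen]
      simpa using Set.ncard_le_card (ball G (r - 1) u)
  have hHcard : ∀ u, r * (H u).card ≤ 2000 * n := by
    intro u
    have h1 : (H u).card ≤ (hubSet G c r offset u).ncard := by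
      rw [Set.ncard_eq_toFinset_card']
      exact Finset.card_image_le
    -- For `r = 1` the trivial bound of `n` hubs is enough, however large the balls are.
    rcases hball with h | h
    · have h2 : (hubSet G c r offset u).ncard ≤ n := by
        simpa using Set.ncard_le_card (hubSet G c r offset u)
      rw [h] at h1 h2 ⊢
      omega
    · have h2 : (hubSet G c r offset u).ncard ≤
          (ball G r u).ncard + (layer G c r u (offset u)).ncard := Set.ncard_union_le _ _
      have h3 := (ho u).2
      rw [Nat.card_eq_fintype_card, Fintype.card_fin] at h3
      have h4 := ncard_ball_le hΔ hdeg r u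
      calc r * (H u).card ≤ r * (2 * Δ ^ r + (layer G c r u (offset u)).ncard) := by
            gcongr
            omega
        _ = 2 * (r * Δ ^ r) + r * (layer G c r u (offset u)).ncard := by ring
        _ ≤ 2000 * n := by omega
  refine ⟨offset, name, fun u => (LabelData.standard n (H u) (e u) (cand u)).label, ho,
    shortestPathCover_hubSet hr fun u => (ho u).1, ?_, ?_, ?_⟩
  · intro u x d
    rw [hubTableOf, LabelData.wordSize_label, LabelData.lookup_label (hfits u) (name x).isLt]
    change (name x : ℕ) ∈ H u ∧ e u (name x) = d ↔ _
    rw [hmem]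
    refine and_congr_right fun hx => ?_
    rw [hex u x (reachable_of_mem_hubSet hx), Nat.cast_inj]
  · intro u
    have h1 := LabelData.length_standard_le hn (he u) hr (hHcard u) (cand := cand u) (by
      calc (cand u).length * digitCount n ^ 2 ≤ 2 * Δ ^ (r - 1) * digitCount n ^ 2 := by
            gcongr
            exact hclen' u
        _ = 2 * (Δ ^ (r - 1) * digitCount n ^ 2) := by ring
        _ ≤ 2000 * n := by omega)
    have hrpos : (0 : ℝ) < r := by exact_mod_cast hr
    have hNpos : (0 : ℝ) < digitCount n := by exact_mod_cast Nat.succ_pos _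
    have h2 := size_div_le hR hr hRr
    have h3 := size_div_le hR (m := digitCount n) (Nat.succ_pos _) (by linarith)
    have h4 : ((LabelData.standard n (H u) (e u) (cand u)).label.length : ℝ) ≤
        10 ^ 10 * (n * ((digitCount n).size / digitCount n + r.size / r)) := by
      have h5 : (r : ℝ) * digitCount n *
          ((LabelData.standard n (H u) (e u) (cand u)).label.length : ℝ) ≤
          10 ^ 10 * (n * (r * (digitCount n).size + digitCount n * r.size)) := by exact_mod_cast h1
      rw [← mul_le_mul_iff_right₀ (mul_pos hrpos hNpos)]
      refine h5.trans_eq ?_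
      field_simp
    calc _ ≤ _ := h4
      _ ≤ 10 ^ 10 * (n * (8 * (Real.logb 2 (1 + Real.logb Δ T) / Real.logb Δ T) +
          8 * (Real.logb 2 (1 + Real.logb Δ T) / Real.logb Δ T))) := by gcongr
      _ = _ := by push_cast; ring
  · intro u v
    obtain ⟨t, ht, hout⟩ := LabelData.decoder_label (hfits u) (hfits v) rfl rfl
      (show 1 ≤ n by omega) (δ := dist G c u v) (by
        intro a ha haH
        obtain ⟨x, hx, rfl⟩ := (hcmem v a).1 ha
        have hux := reachable_of_mem_hubSet ((hmem u x).1 haH)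
        have hvx := reachable_of_mem_ball hx
        change dist G c u v ≤ ((e u (name x) + (dist G c v x).toNat : ℕ) : ℕ∞)
        rw [Nat.cast_add, ← hex u x hux, hd v x hvx, dist_comm (u := v)]
        exact dist_triangle u x v) (by
        intro hδ
        -- The hub of `u` near `v` is among the candidates of `v`, so the minimum is attained.
        obtain ⟨x, hx, hxu, hsum⟩ := exists_hub_mem_ball (c := c) hr (ho u).1
          (dist_ne_top_iff.1 hδ)
        refine ⟨_, (hcmem v _).2 ⟨x, hx, rfl⟩, (hmem u x).2 hxu, ?_⟩
        change dist G c u v = ((e u (name x) + (dist G c v x).toNat : ℕ) : ℕ∞)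
        rw [Nat.cast_add, ← hex u x (reachable_of_mem_hubSet hxu),
          hd v x (reachable_of_mem_ball hx), dist_comm (u := v), hsum])
    refine ⟨t, ?_, hout⟩
    have h1 : t ≤ 68 * Δ ^ (r - 1) + 30 := by
      have := hclen' v
      have h2 : t ≤ 34 * (cand v).length + 30 := ht
      omega
    have h2 : (Δ : ℝ) ^ (r - 1) ≤ T := pow_le_of_le_logb hΔ hT (by
      have : ((r - 1 : ℕ) : ℝ) ≤ r := by exact_mod_cast Nat.sub_le r 1
      linarith)
    have h3 : (t : ℝ) ≤ 68 * (Δ : ℝ) ^ (r - 1) + 30 := by exact_mod_cast h1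
    push_cast
    linarith
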